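/- Let $G$ be a finite simple undirected graph with vertex set $V$. An edge cut of $G$ is a set $M$ of edges for which there is a partition $(R,B)$ of $V$ into two non-empty sets such that $M$ consists of exactly the edges of $G$ with one end-vertex in $R$ and the other in $B$; a matching cut is an edge cut no two edges of which share an end-vertex. (So the empty set is a matching cut of every disconnected graph.) A graph is claw-free if it has no induced subgraph isomorphic to $K_{1,3}$. The problem Minimum Matching Cut asks, for a given graph $G$, for the smallest size $|M|$ of a matching cut $M$ of $G$, or for the answer that $G$ has no matching cut. Theorem. Minimum Matching Cut is solvable in polynomial time on claw-free graphs. That is, there are one algorithm and one polynomial $T$ such that for every $n \ge 0$ and every claw-free graph $G$ on $n$ vertices, given by its adjacency matrix, the algorithm halts after at most $T(n)$ steps and reports correctly whether $G$ has a matching cut and, if it has one, the size of a minimum matching cut of $G$. Here an algorithm is a program for a random access machine over the natural numbers with indirect addressing, addition and truncated subtraction but no multiplication, and with unit cost per elementary operation (a model that is polynomially equivalent to Turing machines). -/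

import Mathlib

/-! ## Matching cuts and claw-free graphs -/

namespace MatchingCut

/-- `M` is an edge cut of `G`: for some partition `(R, Rᶜ)` of the vertex set into two non-empty
parts, `M` consists of exactly the edges of `G` with one end-vertex in each part. -/
def IsEdgeCut {V : Type*} (G : SimpleGraph V) (M : Set (Sym2 V)) : Prop :=
  ∃ R : Set V, R.Nonempty ∧ Rᶜ.Nonempty ∧
    M = {e | ∃ u ∈ R, ∃ v ∈ Rᶜ, G.Adj u v ∧ e = s(u, v)}

/-- A matching cut is an edge cut in which no two distinct edges share an end-vertex. -/
def IsMatchingCut {V : Type*} (G : SimpleGraph V) (M : Set (Sym2 V)) : Prop :=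
  IsEdgeCut G M ∧ ∀ e ∈ M, ∀ f ∈ M, e ≠ f → ∀ v, v ∈ e → v ∉ f

/-- The correct answers to the task "determine the size of a minimum matching cut of `G`":
`some k` if `G` has a matching cut and the smallest ones have exactly `k` edges,
`none` if `G` has no matching cut. -/
def IsMinMatchingCutAnswer {V : Type*} (G : SimpleGraph V) : Option ℕ → Prop
  | none => ¬ ∃ M, IsMatchingCut G M
  | some k => (∃ M, IsMatchingCut G M ∧ M.ncard = k) ∧ ∀ M, IsMatchingCut G M → k ≤ M.ncard

/-- `G` has no induced subgraph isomorphic to the claw `K_{1,3}`. -/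
def ClawFree {V : Type*} (G : SimpleGraph V) : Prop :=
  ¬ (completeBipartiteGraph (Fin 1) (Fin 3)).IsIndContained G

end MatchingCut

/-! ## Random access machines with a step count -/

namespace RAM

/-- Programs of a random access machine with structured control flow. The machine has registers
`0, 1, 2, …` and one-dimensional arrays `0, 1, 2, …`, all holding natural numbers; array cells are
addressed indirectly, by the content of a register. Register and array names and the constants `k`
are part of the program text, so a program uses only finitely many registers and arrays. The only
arithmetic operations are addition and truncated subtraction (there is no multiplication), so
counting one unit of time per operation is polynomially equivalent to Turing machine time. -/
inductive Prog : Type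
  /-- do nothing -/
  | skip : Prog
  /-- `x := k` -/
  | const (x k : ℕ) : Prog
  /-- `x := y` -/
  | copy (x y : ℕ) : Prog
  /-- `x := y + z` -/
  | add (x y z : ℕ) : Prog
  /-- `x := max (y - z) 0` -/
  | sub (x y z : ℕ) : Prog
  /-- `x := a[y]` -/
  | load (x a y : ℕ) : Prog
  /-- `a[x] := y` -/
  | store (a x y : ℕ) : Prog
  /-- first `p`, then `q` -/
  | seq (p q : Prog) : Prog
  /-- if `x ≠ 0` then `p` else `q` -/
  | ite (x : ℕ) (p q : Prog) : Prog
  /-- while `x ≠ 0` do `p` -/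
  | loop (x : ℕ) (p : Prog) : Prog

/-- The memory content: `reg x` is the content of register `x`, and `arr a i` is the content of
cell `i` of array `a`. -/
@[ext]
structure State : Type where
  reg : ℕ → ℕ
  arr : ℕ → ℕ → ℕ

/-- The memory after writing `v` into register `x`. -/
def State.setReg (s : State) (x v : ℕ) : State :=
  { s with reg := Function.update s.reg x v }

/-- The memory after writing `v` into cell `i` of array `a`. -/
def State.setArr (s : State) (a i v : ℕ) : State :=
  { s with arr := Function.update s.arr a (Function.update (s.arr a) i v) }

/-- `Exec p s t s'`: started in memory `s`, the program `p` halts after exactly `t` steps, in memory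
`s'`. Every elementary instruction and every evaluation of a test takes one step. -/
inductive Exec : Prog → State → ℕ → State → Prop
  | skip (s : State) : Exec .skip s 1 s
  | const (s : State) (x k : ℕ) : Exec (.const x k) s 1 (s.setReg x k)
  | copy (s : State) (x y : ℕ) : Exec (.copy x y) s 1 (s.setReg x (s.reg y))
  | add (s : State) (x y z : ℕ) : Exec (.add x y z) s 1 (s.setReg x (s.reg y + s.reg z))
  | sub (s : State) (x y z : ℕ) : Exec (.sub x y z) s 1 (s.setReg x (s.reg y - s.reg z))
  | load (s : State) (x a y : ℕ) : Exec (.load x a y) s 1 (s.setReg x (s.arr a (s.reg y)))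
  | store (s : State) (a x y : ℕ) : Exec (.store a x y) s 1 (s.setArr a (s.reg x) (s.reg y))
  | seq {p q : Prog} {s s' s'' : State} {t t' : ℕ} :
      Exec p s t s' → Exec q s' t' s'' → Exec (.seq p q) s (t + t') s''
  | ite_true {x : ℕ} {p q : Prog} {s s' : State} {t : ℕ} :
      s.reg x ≠ 0 → Exec p s t s' → Exec (.ite x p q) s (t + 1) s'
  | ite_false {x : ℕ} {p q : Prog} {s s' : State} {t : ℕ} :
      s.reg x = 0 → Exec q s t s' → Exec (.ite x p q) s (t + 1) s'
  | loop_done {x : ℕ} {p : Prog} {s : State} :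
      s.reg x = 0 → Exec (.loop x p) s 1 s
  | loop_step {x : ℕ} {p : Prog} {s s' s'' : State} {t t' : ℕ} :
      s.reg x ≠ 0 → Exec p s t s' → Exec (.loop x p) s' t' s'' →
      Exec (.loop x p) s (t + t' + 1) s''

/-- The machine is deterministic: the number of steps and the final memory are determined by the
program and the initial memory. -/
theorem Exec.deterministic {p : Prog} {s s₁ s₂ : State} {t₁ t₂ : ℕ}
    (h₁ : Exec p s t₁ s₁) (h₂ : Exec p s t₂ s₂) : t₁ = t₂ ∧ s₁ = s₂ := by
  induction h₁ generalizing t₂ s₂ with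
  | seq _ _ ih ih' =>
    cases h₂ with
    | seq g g' =>
      obtain ⟨rfl, rfl⟩ := ih g
      obtain ⟨rfl, rfl⟩ := ih' g'
      exact ⟨rfl, rfl⟩
  | ite_true hx _ ih =>
    cases h₂ with
    | ite_true _ g => obtain ⟨rfl, rfl⟩ := ih g; exact ⟨rfl, rfl⟩
    | ite_false hx' _ => exact absurd hx' hx
  | ite_false hx _ ih =>
    cases h₂ with
    | ite_true hx' _ => exact absurd hx hx'
    | ite_false _ g => obtain ⟨rfl, rfl⟩ := ih g; exact ⟨rfl, rfl⟩
  | loop_done hx =>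
    cases h₂ with
    | loop_done _ => exact ⟨rfl, rfl⟩
    | loop_step hx' _ _ => exact absurd hx hx'
  | loop_step hx _ _ ih ih' =>
    cases h₂ with
    | loop_done hx' => exact absurd hx' hx
    | loop_step _ g g' =>
      obtain ⟨rfl, rfl⟩ := ih g
      obtain ⟨rfl, rfl⟩ := ih' g'
      exact ⟨rfl, rfl⟩
  | _ => cases h₂; exact ⟨rfl, rfl⟩

open Classical in
/-- The initial memory for the input graph `G` on the vertices `0, …, n - 1`: register `0` contains
`n`, array `0` contains the adjacency matrix of `G` row by row (cell `u * n + v` is `1` if `u` and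
`v` are adjacent and `0` otherwise), and everything else is `0`. -/
noncomputable def inputState {n : ℕ} (G : SimpleGraph (Fin n)) : State where
  reg x := if x = 0 then n else 0
  arr a i :=
    if a = 0 ∧ ∃ u v : Fin n, i = (u : ℕ) * n + (v : ℕ) ∧ G.Adj u v then 1 else 0

/-- The answer read off from the final memory: `none` if register `1` contains `0`, and otherwise
`some k`, where `k` is the content of register `2`. -/
def State.answer (s : State) : Option ℕ :=
  if s.reg 1 = 0 then none else some (s.reg 2)

/-- On the graph class `C`, the graph problem with correct answers `Correct` is solvable in
polynomial time: one program halts on every graph of the class with a correct answer, after a number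
of steps that is bounded by a fixed polynomial in the number of vertices. -/
def PolyTimeSolvableOn (C : ∀ n : ℕ, SimpleGraph (Fin n) → Prop)
    (Correct : ∀ n : ℕ, SimpleGraph (Fin n) → Option ℕ → Prop) : Prop :=
  ∃ (p : Prog) (T : Polynomial ℕ), ∀ (n : ℕ) (G : SimpleGraph (Fin n)), C n G →
    ∃ (t : ℕ) (s : State), Exec p (inputState G) t s ∧ t ≤ T.eval n ∧ Correct n G s.answer

end RAM

/-!
Call an edge *good* if it lies in no triangle. A matching cut contains good edges only, because a
triangle cannot be cut in one edge. In a claw-free graph the neighbors of `u` other than `v` are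
pairwise adjacent when `uv` is good, so a vertex with two good edges has degree two
(`NoClaw.eq_or_eq`). Hence a set of good edges that forms an edge cut can fail to be a matching cut
only at vertices of degree two. There are two cases.

* Some good edge `uv` joins two vertices that both have a second good edge (`Flagged`). Then
  `{u, v}` is one side of a matching cut with two edges, and an edge cut with at most one edge is a
  matching cut anyway, so that the answer is the minimum of `2` and the smallest size of
  an edge cut.
* Otherwise, forbid the edges in triangles and, at every vertex with two good edges, the edge to the
  smaller neighbor (`Heavy`). An edge cut without forbidden edges is a matching cut
  (`matching_of_cut_lt`). Conversely, moving vertices of degree two to the other side turns every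
  matching cut into a cut of the same size without forbidden edges (`Matching.exists_cut_le`). So
  the answer is the minimum weight of a cut, when the forbidden edges weigh more than all others
  together.

`isLeast_sizes` puts the cases together. The minimum cut is found with the algorithm of Stoer and
Wagner: in each phase the last vertex `t` of a maximum adjacency ordering determines a minimum cut
between `t` and the vertex `s` before it (`Segment.insert`), so that this cut can be recorded and
`s` and `t` can be merged (`Progress.merge`).

For the machine model, algorithms are written in a language of commands whose loops all run `n`
times and of expressions with sums over `0, …, n - 1`. Such a command has a running time that is
bounded by a polynomial read off from its text, and a compiler into machine programs is verified
once and for all (`RAM.Cmd.runs_compile`). What remains is to verify the effect of one command,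
`RAM.matchingCutC`, which is done with loop invariants (`RAM.matchingCutC_spec`).
-/

/-! ### Running time, expressions and structured commands -/

namespace RAM

/-- `Runs p s T s'`: started in memory `s`, the program `p` halts after at most `T` steps, in memory
`s'`. -/
def Runs (p : Prog) (s : State) (T : ℕ) (s' : State) : Prop :=
  ∃ t ≤ T, Exec p s t s'

theorem Exec.runs {p : Prog} {s s' : State} {t : ℕ} (h : Exec p s t s') : Runs p s t s' :=
  ⟨t, le_rfl, h⟩

theorem Runs.mono {p : Prog} {s s' : State} {T T' : ℕ} (h : Runs p s T s') (hT : T ≤ T') :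
    Runs p s T' s' :=
  let ⟨t, ht, e⟩ := h
  ⟨t, ht.trans hT, e⟩

theorem Runs.seq {p q : Prog} {s s' s'' : State} {T T' : ℕ} (h : Runs p s T s')
    (h' : Runs q s' T' s'') : Runs (.seq p q) s (T + T') s'' :=
  let ⟨t, ht, e⟩ := h
  let ⟨t', ht', e'⟩ := h'
  ⟨t + t', add_le_add ht ht', .seq e e'⟩

/-- A loop whose test register holds the number of remaining iterations, as long as an
invariant `Q` that determines this number is maintained. -/
theorem Runs.loop {c : ℕ} {p : Prog} {n T : ℕ} {Q : ℕ → State → Prop}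
    (hc : ∀ k s, Q k s → s.reg c = n - k)
    (hp : ∀ k < n, ∀ s, Q k s → ∃ s', Runs p s T s' ∧ Q (k + 1) s') {s : State} (h0 : Q 0 s) :
    ∃ s', Runs (.loop c p) s (n * (T + 1) + 1) s' ∧ Q n s' := by
  have key : ∀ m k s, k + m = n → Q k s →
      ∃ s', Runs (.loop c p) s (m * (T + 1) + 1) s' ∧ Q n s' := by
    intro m
    induction m with
    | zero =>
      intro k s hk hQ
      obtain rfl : k = n := by omega
      exact ⟨s, ⟨1, by omega, .loop_done (by rw [hc _ _ hQ]; omega)⟩, hQ⟩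
    | succ m ih =>
      intro k s hk hQ
      obtain ⟨s', ⟨t, ht, e⟩, hQ'⟩ := hp k (by omega) s hQ
      obtain ⟨s'', ⟨t', ht', e'⟩, hQ''⟩ := ih (k + 1) s' (by omega) hQ'
      refine ⟨s'', ⟨t + t' + 1, ?_, .loop_step ?_ e e'⟩, hQ''⟩
      · rw [add_mul]; omega
      · rw [hc _ _ hQ]; omega
  exact key n 0 s (by omega) h0

@[simp] theorem State.setReg_reg (s : State) (x v y : ℕ) :
    (s.setReg x v).reg y = if y = x then v else s.reg y := by
  simp [State.setReg, Function.update_apply]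

@[simp] theorem State.setReg_arr (s : State) (x v : ℕ) : (s.setReg x v).arr = s.arr := rfl

@[simp] theorem State.setArr_reg (s : State) (a i v : ℕ) : (s.setArr a i v).reg = s.reg := rfl

@[simp] theorem State.setArr_arr (s : State) (a i v b j : ℕ) :
    (s.setArr a i v).arr b j = if b = a ∧ j = i then v else s.arr b j := by
  by_cases h : b = a
  · subst h; simp [State.setArr, Function.update_apply]
  · simp [State.setArr, h]

/-- The relation between the memory of a command and that of the compiled program, which uses the
registers from `d` on as scratch space: the two memories agree on all arrays and on the registers
below `d`. -/
def Agree (d : ℕ) (s s' : State) : Prop :=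
  s'.arr = s.arr ∧ ∀ x < d, s'.reg x = s.reg x

theorem Agree.refl (d : ℕ) (s : State) : Agree d s s := ⟨rfl, fun _ _ => rfl⟩

theorem Agree.trans {d : ℕ} {s s' s'' : State} (h : Agree d s s') (h' : Agree d s' s'') :
    Agree d s s'' :=
  ⟨h'.1.trans h.1, fun x hx => (h'.2 x hx).trans (h.2 x hx)⟩

theorem Agree.mono {d d' : ℕ} {s s' : State} (h : Agree d' s s') (hd : d ≤ d') : Agree d s s' :=
  ⟨h.1, fun x hx => h.2 x (hx.trans_le hd)⟩

theorem Agree.setReg {d : ℕ} {s s' : State} (h : Agree d s s') (x v : ℕ) :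
    Agree d (s.setReg x v) (s'.setReg x v) :=
  ⟨h.1, fun y hy => by simp [h.2 y hy]⟩

theorem Agree.setReg_right {d : ℕ} {s s' : State} (h : Agree d s s') {x : ℕ} (hx : d ≤ x) (v : ℕ) :
    Agree d s (s'.setReg x v) :=
  ⟨h.1, fun y hy => by simp [h.2 y hy, (hy.trans_le hx).ne]⟩

theorem Agree.setArr {d : ℕ} {s s' : State} (h : Agree d s s') (a i v : ℕ) :
    Agree d (s.setArr a i v) (s'.setArr a i v) :=
  ⟨by simp only [State.setArr, h.1], fun y hy => by simp [h.2 y hy]⟩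

/-- Side-effect free expressions over the registers and arrays. `sum x e` is the sum of the values
of `e` for `x = 0, …, n - 1`, where `n` is the content of register `0`, and `x` is local to `e`. -/
inductive Expr : Type
  | const (k : ℕ) : Expr
  | reg (x : ℕ) : Expr
  | arr (a : ℕ) (e : Expr) : Expr
  | add (e₁ e₂ : Expr) : Expr
  | sub (e₁ e₂ : Expr) : Expr
  | cond (c e₁ e₂ : Expr) : Expr
  | sum (x : ℕ) (e : Expr) : Expr

namespace Expr

/-- The value of an expression. -/
@[simp] def eval : Expr → State → ℕ
  | const k, _ => k
  | reg x, s => s.reg x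
  | arr a e, s => s.arr a (e.eval s)
  | add e₁ e₂, s => e₁.eval s + e₂.eval s
  | sub e₁ e₂, s => e₁.eval s - e₂.eval s
  | cond c e₁ e₂, s => if c.eval s ≠ 0 then e₁.eval s else e₂.eval s
  | sum x e, s => ∑ k ∈ Finset.range (s.reg 0), e.eval (s.setReg x k)

/-- All registers of the expression are below `d`, and register `0` is never bound. -/
def wf (d : ℕ) : Expr → Bool
  | const _ => true
  | reg x => decide (x < d)
  | arr _ e => e.wf d
  | add e₁ e₂ => e₁.wf d && e₂.wf d
  | sub e₁ e₂ => e₁.wf d && e₂.wf d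
  | cond c e₁ e₂ => c.wf d && e₁.wf d && e₂.wf d
  | sum x e => decide (x < d) && decide (x ≠ 0) && e.wf d

/-- Code that writes the value of the expression into register `d` and uses the registers from `d`
on as scratch space. The bound register of a sum is saved and restored. -/
def compile : Expr → ℕ → Prog
  | const k, d => .const d k
  | reg x, d => .copy d x
  | arr a e, d => .seq (e.compile d) (.load d a d)
  | add e₁ e₂, d => .seq (.seq (e₁.compile d) (e₂.compile (d + 1))) (.add d d (d + 1))
  | sub e₁ e₂, d => .seq (.seq (e₁.compile d) (e₂.compile (d + 1))) (.sub d d (d + 1))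
  | cond c e₁ e₂, d => .seq (c.compile d) (.ite d (e₁.compile d) (e₂.compile d))
  | sum x e, d =>
    .seq (.seq (.seq (.seq (.seq (.const d 0) (.copy (d + 1) x)) (.const x 0)) (.sub (d + 2) 0 x))
      (.loop (d + 2) (.seq (.seq (.seq (.seq (e.compile (d + 2)) (.add d d (d + 2)))
        (.const (d + 2) 1)) (.add x x (d + 2))) (.sub (d + 2) 0 x)))) (.copy x (d + 1))

/-- A bound for the running time of the compiled expression, as a polynomial in the content of
register `0`. -/
noncomputable def cost : Expr → Polynomial ℕ
  | const _ => 1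
  | reg _ => 1
  | arr _ e => e.cost + 1
  | add e₁ e₂ => e₁.cost + e₂.cost + 1
  | sub e₁ e₂ => e₁.cost + e₂.cost + 1
  | cond c e₁ e₂ => c.cost + (e₁.cost + e₂.cost + 1)
  | sum _ e => 4 + (Polynomial.X * (e.cost + 4 + 1) + 1) + 1

theorem wf_mono {d d' : ℕ} (hd : d ≤ d') {e : Expr} (h : e.wf d = true) : e.wf d' = true := by
  induction e with
  | const k => rfl
  | reg x => simp only [wf, decide_eq_true_eq] at *; omega
  | arr a e ih => exact ih h
  | add e₁ e₂ ih₁ ih₂ => simp only [wf, Bool.and_eq_true] at *; exact ⟨ih₁ h.1, ih₂ h.2⟩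
  | sub e₁ e₂ ih₁ ih₂ => simp only [wf, Bool.and_eq_true] at *; exact ⟨ih₁ h.1, ih₂ h.2⟩
  | cond c e₁ e₂ ih ih₁ ih₂ =>
    simp only [wf, Bool.and_eq_true] at *; exact ⟨⟨ih h.1.1, ih₁ h.1.2⟩, ih₂ h.2⟩
  | sum x e ih =>
    simp only [wf, Bool.and_eq_true, decide_eq_true_eq] at *
    exact ⟨⟨by omega, h.1.2⟩, ih h.2⟩

theorem eval_congr {d : ℕ} {e : Expr} (h : e.wf d = true) {s s' : State} (hs : Agree d s s') :
    e.eval s' = e.eval s := by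
  induction e generalizing s s' with
  | const k => rfl
  | reg x => simp only [wf, decide_eq_true_eq] at h; exact hs.2 x h
  | arr a e ih => simp [ih h hs, hs.1]
  | add e₁ e₂ ih₁ ih₂ =>
    simp only [wf, Bool.and_eq_true] at h; simp [ih₁ h.1 hs, ih₂ h.2 hs]
  | sub e₁ e₂ ih₁ ih₂ =>
    simp only [wf, Bool.and_eq_true] at h; simp [ih₁ h.1 hs, ih₂ h.2 hs]
  | cond c e₁ e₂ ih ih₁ ih₂ =>
    simp only [wf, Bool.and_eq_true] at h; simp [ih h.1.1 hs, ih₁ h.1.2 hs, ih₂ h.2 hs]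
  | sum x e ih =>
    simp only [wf, Bool.and_eq_true, decide_eq_true_eq] at h
    simp only [eval, hs.2 0 (by omega)]
    exact Finset.sum_congr rfl fun k _ => ih h.2 (hs.setReg x k)

/-- The compiled expression computes its value in register `d` and preserves the arrays and the
registers below `d`. -/
theorem runs_compile {e : Expr} {d : ℕ} (hd : 0 < d) (h : e.wf d = true) (s : State) :
    ∃ s', Runs (e.compile d) s (e.cost.eval (s.reg 0)) s' ∧ Agree d s s' ∧
      s'.reg d = e.eval s := by
  induction e generalizing d s with
  | const k =>
    exact ⟨_, by simpa [cost, compile] using (Exec.const s d k).runs, (Agree.refl d s).setReg_right le_rfl _,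
      by simp⟩
  | reg x =>
    exact ⟨_, by simpa [cost, compile] using (Exec.copy s d x).runs, (Agree.refl d s).setReg_right le_rfl _,
      by simp⟩
  | arr a e ih =>
    obtain ⟨s₁, r₁, a₁, v₁⟩ := ih hd h s
    refine ⟨_, by simpa [cost, compile] using r₁.seq (Exec.load s₁ d a d).runs,
      a₁.setReg_right le_rfl _, by simp [v₁, a₁.1]⟩
  | add e₁ e₂ ih₁ ih₂ =>
    simp only [wf, Bool.and_eq_true] at h
    obtain ⟨s₁, r₁, a₁, v₁⟩ := ih₁ hd h.1 s
    obtain ⟨s₂, r₂, a₂, v₂⟩ := ih₂ (d := d + 1) (by omega) (wf_mono (by omega) h.2) s₁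
    rw [a₁.2 0 hd] at r₂
    refine ⟨_, by simpa [cost, compile] using (r₁.seq r₂).seq (Exec.add s₂ d d (d + 1)).runs,
      (a₁.trans (a₂.mono (by omega))).setReg_right le_rfl _, ?_⟩
    simp [v₂, a₂.2 d (by omega), v₁, eval_congr h.2 a₁]
  | sub e₁ e₂ ih₁ ih₂ =>
    simp only [wf, Bool.and_eq_true] at h
    obtain ⟨s₁, r₁, a₁, v₁⟩ := ih₁ hd h.1 s
    obtain ⟨s₂, r₂, a₂, v₂⟩ := ih₂ (d := d + 1) (by omega) (wf_mono (by omega) h.2) s₁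
    rw [a₁.2 0 hd] at r₂
    refine ⟨_, by simpa [cost, compile] using (r₁.seq r₂).seq (Exec.sub s₂ d d (d + 1)).runs,
      (a₁.trans (a₂.mono (by omega))).setReg_right le_rfl _, ?_⟩
    simp [v₂, a₂.2 d (by omega), v₁, eval_congr h.2 a₁]
  | cond c e₁ e₂ ih ih₁ ih₂ =>
    simp only [wf, Bool.and_eq_true] at h
    obtain ⟨s₁, r₁, a₁, v₁⟩ := ih hd h.1.1 s
    by_cases hc : c.eval s ≠ 0
    · obtain ⟨s₂, ⟨t, ht, r₂⟩, a₂, v₂⟩ := ih₁ hd h.1.2 s₁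
      rw [a₁.2 0 hd] at ht
      refine ⟨s₂, (r₁.seq (Exec.ite_true (v₁ ▸ hc) r₂).runs).mono ?_, a₁.trans a₂, ?_⟩
      · simp only [cost, Polynomial.eval_add, Polynomial.eval_one]; omega
      · simp only [eval, if_pos hc]; rw [v₂, eval_congr h.1.2 a₁]
    · obtain ⟨s₂, ⟨t, ht, r₂⟩, a₂, v₂⟩ := ih₂ hd h.2 s₁
      rw [a₁.2 0 hd] at ht
      refine ⟨s₂, (r₁.seq (Exec.ite_false (v₁ ▸ not_not.1 hc) r₂).runs).mono ?_, a₁.trans a₂, ?_⟩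
      · simp only [cost, Polynomial.eval_add, Polynomial.eval_one]; omega
      · simp only [eval, if_neg hc]; rw [v₂, eval_congr h.2 a₁]
  | sum x e ih =>
    simp only [wf, Bool.and_eq_true, decide_eq_true_eq] at h
    obtain ⟨⟨hx, hx0⟩, he⟩ := h
    have h0x : 0 ≠ x := Ne.symm hx0
    set n := s.reg 0 with hn
    -- After `k` iterations, register `d` holds the partial sum, `d + 1` the saved value of `x`,
    -- and `d + 2` the number of remaining iterations.
    let Q : ℕ → State → Prop := fun k s' => Agree d (s.setReg x k) s' ∧
      s'.reg d = ∑ j ∈ Finset.range k, e.eval (s.setReg x j) ∧ s'.reg (d + 1) = s.reg x ∧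
      s'.reg (d + 2) = n - k
    obtain ⟨s', r', ha, hv, hsave, -⟩ := Runs.loop (c := d + 2)
      (p := .seq (.seq (.seq (.seq (e.compile (d + 2)) (.add d d (d + 2)))
        (.const (d + 2) 1)) (.add x x (d + 2))) (.sub (d + 2) 0 x)) (n := n)
      (T := e.cost.eval n + 4) (Q := Q)
      (s := (((s.setReg d 0).setReg (d + 1) (s.reg x)).setReg x 0).setReg (d + 2) n)
      (fun k s' hQ => hQ.2.2.2)
      (by
        rintro k hk s' ⟨a, hv, hsave, -⟩
        obtain ⟨s₁, r₁, a₁, v₁⟩ := ih (d := d + 2) (by omega) (wf_mono (by omega) he) s'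
        have h0 : s'.reg 0 = n := by rw [a.2 0 hd]; simp [h0x, hn]
        have hxk : s₁.reg x = k := by rw [a₁.2 x (by omega), a.2 x hx]; simp
        have h01 : s₁.reg 0 = n := by rw [a₁.2 0 (by omega), h0]
        rw [h0] at r₁
        refine ⟨_, (((r₁.seq (Exec.add _ d d (d + 2)).runs).seq
          (Exec.const _ (d + 2) 1).runs).seq (Exec.add _ x x (d + 2)).runs).seq
          (Exec.sub _ (d + 2) 0 x).runs, ?_⟩
        have e1 : x ≠ d := hx.ne
        have e2 : x ≠ d + 1 := by omega
        have e3 : x ≠ d + 2 := by omega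
        refine ⟨⟨by simp [a₁.1, a.1], fun y hy => ?_⟩, ?_, ?_, ?_⟩
        · have f1 : y ≠ d := hy.ne
          have f3 : y ≠ d + 2 := by omega
          by_cases hyx : y = x
          · subst hyx; simp [f1, f3, hxk]
          · simp [f1, f3, hyx, a₁.2 y (by omega), a.2 y hy]
        · simp [e1.symm, Finset.sum_range_succ, a₁.2 d (by omega), hv, v₁, eval_congr he a]
        · simp [e2.symm, a₁.2 (d + 1) (by omega), hsave]
        · simp [e1, e3, h0x, hd.ne, h01, hxk])
      (by
        have e1 : x ≠ d := hx.ne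
        have e2 : x ≠ d + 1 := by omega
        have e3 : x ≠ d + 2 := by omega
        refine ⟨⟨by simp, fun y hy => ?_⟩, ?_, ?_, ?_⟩
        · have f1 : y ≠ d := hy.ne
          have f2 : y ≠ d + 1 := by omega
          have f3 : y ≠ d + 2 := by omega
          simp [f1, f2, f3]
        · simp [e1.symm]
        · simp [e2.symm]
        · simp)
    refine ⟨s'.setReg x (s.reg x), ?_, ⟨by simp [ha.1], fun y hy => ?_⟩, ?_⟩
    · have hc := (Exec.copy s' x (d + 1)).runs
      rw [hsave] at hc
      have r1 := (Exec.const s d 0).runs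
      have r2 := r1.seq (Exec.copy _ (d + 1) x).runs
      have r3 := r2.seq (Exec.const _ x 0).runs
      have r4 := r3.seq (Exec.sub _ (d + 2) 0 x).runs
      have f : ((((s.setReg d 0).setReg (d + 1) ((s.setReg d 0).reg x)).setReg x 0).setReg (d + 2)
          (((((s.setReg d 0).setReg (d + 1) ((s.setReg d 0).reg x)).setReg x 0)).reg 0 -
          ((((s.setReg d 0).setReg (d + 1) ((s.setReg d 0).reg x)).setReg x 0)).reg x)) =
          (((s.setReg d 0).setReg (d + 1) (s.reg x)).setReg x 0).setReg (d + 2) n := by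
        simp [hx.ne, h0x, hd.ne, hn]
      rw [f] at r4
      refine ((r4.seq r').seq hc).mono ?_
      simp [cost]
    · by_cases hyx : y = x
      · simp [hyx]
      · simp [hyx, ha.2 y hy]
    · simp [hx.ne', hv, hn]

end Expr

/-- Commands. Every `loop i p` runs through its body `p` for `i = 0, …, n - 1`, where `n` is the
content of register `0`. -/
inductive Cmd : Type
  | skip : Cmd
  | assign (x : ℕ) (e : Expr) : Cmd
  | store (a : ℕ) (e₁ e₂ : Expr) : Cmd
  | seq (p q : Cmd) : Cmd
  | ite (e : Expr) (p q : Cmd) : Cmd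
  | loop (i : ℕ) (p : Cmd) : Cmd

namespace Cmd

/-- The registers a command may change. -/
def writesReg : Cmd → ℕ → Bool
  | skip, _ => false
  | assign x _, y => x == y
  | store _ _ _, _ => false
  | seq p q, y => p.writesReg y || q.writesReg y
  | ite _ p q, y => p.writesReg y || q.writesReg y
  | loop i p, y => i == y || p.writesReg y

/-- The arrays a command may change. -/
def writesArr : Cmd → ℕ → Bool
  | skip, _ => false
  | assign _ _, _ => false
  | store a _ _, b => a == b
  | seq p q, b => p.writesArr b || q.writesArr b
  | ite _ p q, b => p.writesArr b || q.writesArr b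
  | loop _ p, b => p.writesArr b

/-- The memory after the execution of a command. As in the compiled program, a loop leaves `n` in its
loop register. -/
noncomputable def run : Cmd → State → State
  | skip, s => s
  | assign x e, s => s.setReg x (e.eval s)
  | store a e₁ e₂, s => s.setArr a (e₁.eval s) (e₂.eval s)
  | seq p q, s => q.run (p.run s)
  | ite e p q, s => if e.eval s ≠ 0 then p.run s else q.run s
  | loop i p, s =>
    Nat.rec (s.setReg i 0) (fun k s' => (p.run s').setReg i (k + 1)) (s.reg 0)

/-- All registers of the command are below `d`, register `0` is not changed, and the body of a loop
does not change the loop register. -/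
def wf (d : ℕ) : Cmd → Bool
  | skip => true
  | assign x e => decide (x < d) && decide (x ≠ 0) && e.wf d
  | store _ e₁ e₂ => e₁.wf d && e₂.wf d
  | seq p q => p.wf d && q.wf d
  | ite e p q => e.wf d && p.wf d && q.wf d
  | loop i p => decide (i < d) && decide (i ≠ 0) && (p.writesReg i == false) && p.wf d

/-- Code for a command, with scratch space from register `d` on. -/
def compile (d : ℕ) : Cmd → Prog
  | skip => .skip
  | assign x e => .seq (e.compile d) (.copy x d)
  | store a e₁ e₂ => .seq (.seq (e₁.compile d) (e₂.compile (d + 1))) (.store a d (d + 1))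
  | seq p q => .seq (p.compile d) (q.compile d)
  | ite e p q => .seq (e.compile d) (.ite d (p.compile d) (q.compile d))
  | loop i p =>
    .seq (.seq (.const i 0) (.sub d 0 i))
      (.loop d (.seq (.seq (.seq (p.compile d) (.const d 1)) (.add i i d)) (.sub d 0 i)))

/-- A bound for the running time of the compiled command, as a polynomial in the content of
register `0`. -/
noncomputable def cost : Cmd → Polynomial ℕ
  | skip => 1
  | assign _ e => e.cost + 1
  | store _ e₁ e₂ => e₁.cost + e₂.cost + 1
  | seq p q => p.cost + q.cost
  | ite e p q => e.cost + (p.cost + q.cost + 1)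
  | loop _ p => 2 + (Polynomial.X * (p.cost + 3 + 1) + 1)

theorem run_reg {c : Cmd} {x : ℕ} (h : c.writesReg x = false) (s : State) :
    (c.run s).reg x = s.reg x := by
  induction c generalizing s with
  | skip => rfl
  | assign y e => simp only [writesReg, beq_eq_false_iff_ne] at h; simp [run, Ne.symm h]
  | store a e₁ e₂ => rfl
  | seq p q ihp ihq =>
    simp only [writesReg, Bool.or_eq_false_iff] at h; simp [run, ihq h.2, ihp h.1]
  | ite e p q ihp ihq =>
    simp only [writesReg, Bool.or_eq_false_iff] at h
    simp only [run]; split_ifs <;> simp [ihp h.1, ihq h.2]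
  | loop i p ih =>
    simp only [writesReg, Bool.or_eq_false_iff, beq_eq_false_iff_ne] at h
    simp only [run]
    induction s.reg 0 with
    | zero => simp [Ne.symm h.1]
    | succ k ihk => simp [Ne.symm h.1, ih h.2, ihk]

theorem run_arr {c : Cmd} {a : ℕ} (h : c.writesArr a = false) (s : State) :
    (c.run s).arr a = s.arr a := by
  induction c generalizing s with
  | skip => rfl
  | assign y e => rfl
  | store b e₁ e₂ =>
    simp only [writesArr, beq_eq_false_iff_ne] at h
    funext i; simp [run, Ne.symm h]
  | seq p q ihp ihq =>
    simp only [writesArr, Bool.or_eq_false_iff] at h; simp [run, ihq h.2, ihp h.1]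
  | ite e p q ihp ihq =>
    simp only [writesArr, Bool.or_eq_false_iff] at h
    simp only [run]; split_ifs <;> simp [ihp h.1, ihq h.2]
  | loop i p ih =>
    simp only [writesArr] at h
    simp only [run]
    induction s.reg 0 with
    | zero => rfl
    | succ k ihk => simp [ih h, ihk]

theorem writesReg_zero {d : ℕ} {c : Cmd} (h : c.wf d = true) : c.writesReg 0 = false := by
  induction c with
  | skip => rfl
  | assign y e =>
    simp only [wf, Bool.and_eq_true, decide_eq_true_eq] at h; simpa [writesReg] using h.1.2
  | store b e₁ e₂ => rfl
  | seq p q ihp ihq =>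
    simp only [wf, Bool.and_eq_true] at h; simp [writesReg, ihp h.1, ihq h.2]
  | ite e p q ihp ihq =>
    simp only [wf, Bool.and_eq_true] at h; simp [writesReg, ihp h.1.2, ihq h.2]
  | loop i p ih =>
    simp only [wf, Bool.and_eq_true, decide_eq_true_eq] at h
    simp [writesReg, ih h.2, h.1.1.2]

/-- The compiler is correct: scratch registers apart, the compiled command has the effect of the
command, within the time bound. -/
theorem runs_compile {c : Cmd} {d : ℕ} (hd : 0 < d) (h : c.wf d = true) {s t : State}
    (hst : Agree d s t) :
    ∃ t', Runs (c.compile d) t (c.cost.eval (s.reg 0)) t' ∧ Agree d (c.run s) t' := by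
  induction c generalizing s t with
  | skip => exact ⟨t, by simpa [cost, compile] using (Exec.skip t).runs, hst⟩
  | assign x e =>
    simp only [wf, Bool.and_eq_true, decide_eq_true_eq] at h
    obtain ⟨t₁, r₁, a₁, v₁⟩ := e.runs_compile hd h.2 t
    rw [hst.2 0 hd] at r₁
    refine ⟨_, by simpa [cost, compile] using r₁.seq (Exec.copy t₁ x d).runs, ?_⟩
    rw [v₁, Expr.eval_congr h.2 hst]
    exact (hst.trans a₁).setReg _ _
  | store a e₁ e₂ =>
    simp only [wf, Bool.and_eq_true] at h
    obtain ⟨t₁, r₁, a₁, v₁⟩ := e₁.runs_compile hd h.1 t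
    obtain ⟨t₂, r₂, a₂, v₂⟩ := e₂.runs_compile (d := d + 1) (by omega)
      (Expr.wf_mono (by omega) h.2) t₁
    rw [a₁.2 0 hd] at r₂
    rw [hst.2 0 hd] at r₁ r₂
    refine ⟨_, by simpa [cost, compile] using (r₁.seq r₂).seq (Exec.store t₂ a d (d + 1)).runs, ?_⟩
    rw [v₂, a₂.2 d (by omega), v₁, Expr.eval_congr h.2 (hst.trans a₁), Expr.eval_congr h.1 hst]
    exact (hst.trans (a₁.trans (a₂.mono (by omega)))).setArr _ _ _
  | seq p q ihp ihq =>
    simp only [wf, Bool.and_eq_true] at h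
    obtain ⟨t₁, r₁, a₁⟩ := ihp h.1 hst
    obtain ⟨t₂, r₂, a₂⟩ := ihq h.2 a₁
    rw [run_reg (writesReg_zero h.1)] at r₂
    exact ⟨t₂, by simpa [cost, compile] using r₁.seq r₂, a₂⟩
  | ite e p q ihp ihq =>
    simp only [wf, Bool.and_eq_true] at h
    obtain ⟨t₁, r₁, a₁, v₁⟩ := e.runs_compile hd h.1.1 t
    rw [hst.2 0 hd] at r₁
    rw [Expr.eval_congr h.1.1 hst] at v₁
    by_cases he : e.eval s ≠ 0
    · obtain ⟨t₂, ⟨k, hk, r₂⟩, a₂⟩ := ihp h.1.2 (hst.trans a₁)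
      refine ⟨t₂, (r₁.seq (Exec.ite_true (v₁ ▸ he) r₂).runs).mono ?_, by simpa only [run, if_pos he]⟩
      simp only [cost, Polynomial.eval_add, Polynomial.eval_one]; omega
    · obtain ⟨t₂, ⟨k, hk, r₂⟩, a₂⟩ := ihq h.2 (hst.trans a₁)
      refine ⟨t₂, (r₁.seq (Exec.ite_false (v₁ ▸ not_not.1 he) r₂).runs).mono ?_,
        by simpa only [run, if_neg he]⟩
      simp only [cost, Polynomial.eval_add, Polynomial.eval_one]; omega
  | loop i p ih =>
    simp only [wf, Bool.and_eq_true, decide_eq_true_eq, beq_iff_eq] at h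
    obtain ⟨⟨⟨hi, hi0⟩, hpi⟩, hp⟩ := h
    have h0i : 0 ≠ i := Ne.symm hi0
    set n := s.reg 0 with hn
    -- The memory at the start of iteration `k`.
    let σ : ℕ → State := fun k =>
      Nat.rec (s.setReg i 0) (fun k s' => (p.run s').setReg i (k + 1)) k
    have σ0 : ∀ k, (σ k).reg 0 = n := by
      intro k
      induction k with
      | zero => simp [σ, h0i, hn]
      | succ k ihk =>
        change ((p.run (σ k)).setReg i (k + 1)).reg 0 = n
        simp [h0i, run_reg (writesReg_zero hp), ihk]
    have σi : ∀ k, (σ k).reg i = k := by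
      intro k; cases k <;> simp [σ]
    obtain ⟨t', r', ha, -⟩ := Runs.loop (c := d)
      (p := .seq (.seq (.seq (p.compile d) (.const d 1)) (.add i i d)) (.sub d 0 i)) (n := n)
      (T := p.cost.eval n + 3) (Q := fun k t => Agree d (σ k) t ∧ t.reg d = n - k)
      (s := (t.setReg i 0).setReg d n) (fun k t h => h.2)
      (by
        rintro k hk t ⟨a, -⟩
        obtain ⟨t₁, r₁, a₁⟩ := ih hp a
        have h01 : t₁.reg 0 = n := by rw [a₁.2 0 hd, run_reg (writesReg_zero hp), σ0]
        have hi1 : t₁.reg i = k := by rw [a₁.2 i hi, run_reg hpi, σi]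
        rw [σ0] at r₁
        refine ⟨_, ((r₁.seq (Exec.const _ d 1).runs).seq (Exec.add _ i i d).runs).seq
          (Exec.sub _ d 0 i).runs, ⟨?_, fun y hy => ?_⟩, ?_⟩
        · change _ = ((p.run (σ k)).setReg i (k + 1)).arr
          simp [a₁.1]
        · change _ = ((p.run (σ k)).setReg i (k + 1)).reg y
          by_cases hyi : y = i
          · simp [hyi, hi.ne, hi1]
          · simp [hyi, hy.ne, a₁.2 y hy]
        · simp [h0i, hi.ne, hd.ne, h01, hi1])
      ⟨(hst.setReg i 0).setReg_right le_rfl _, by simp⟩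
    refine ⟨t', ?_, ha⟩
    have r1 := (Exec.const t i 0).runs.seq (Exec.sub _ d 0 i).runs
    have f : (t.setReg i 0).setReg d ((t.setReg i 0).reg 0 - (t.setReg i 0).reg i) =
        (t.setReg i 0).setReg d n := by simp [h0i, hst.2 0 hd, hn]
    rw [f] at r1
    refine (r1.seq r').mono ?_
    simp [cost]

/-- The invariant rule for loops. The invariant need not mention the registers and arrays that the
loop does not change. -/
theorem run_loop {i : ℕ} {p : Cmd} {s : State} (Inv : ℕ → State → Prop)
    (init : Inv 0 (s.setReg i 0))
    (step : ∀ k < s.reg 0, ∀ s' : State, s'.reg i = k →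
      (∀ x, x ≠ i → p.writesReg x = false → s'.reg x = s.reg x) →
      (∀ a, p.writesArr a = false → s'.arr a = s.arr a) →
      Inv k s' → Inv (k + 1) ((p.run s').setReg i (k + 1))) :
    Inv (s.reg 0) ((loop i p).run s) := by
  let σ : ℕ → State := fun k =>
    Nat.rec (s.setReg i 0) (fun k s' => (p.run s').setReg i (k + 1)) k
  have key : ∀ k ≤ s.reg 0, (σ k).reg i = k ∧
      (∀ x, x ≠ i → p.writesReg x = false → (σ k).reg x = s.reg x) ∧
      (∀ a, p.writesArr a = false → (σ k).arr a = s.arr a) ∧ Inv k (σ k) := by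
    intro k
    induction k with
    | zero => exact fun _ => ⟨by simp [σ], fun x hx _ => by simp [σ, hx], fun a _ => rfl, init⟩
    | succ k ih =>
      intro hk
      obtain ⟨e1, e2, e3, e4⟩ := ih (by omega)
      have hσ : σ (k + 1) = (p.run (σ k)).setReg i (k + 1) := rfl
      rw [hσ]
      exact ⟨by simp, fun x hx hp => by simp [hx, run_reg hp, e2 x hx hp],
        fun a ha => by simp [run_arr ha, e3 a ha], step k (by omega) _ e1 e2 e3 e4⟩
  exact (key _ le_rfl).2.2.2

end Cmd

/-- A command that produces correct answers solves the problem in polynomial time. -/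
theorem polyTimeSolvableOn_of_cmd {C : ∀ n : ℕ, SimpleGraph (Fin n) → Prop}
    {Correct : ∀ n : ℕ, SimpleGraph (Fin n) → Option ℕ → Prop} (c : Cmd) (d : ℕ) (hd : 2 < d)
    (hc : c.wf d = true)
    (h : ∀ (n : ℕ) (G : SimpleGraph (Fin n)), C n G → Correct n G (c.run (inputState G)).answer) :
    PolyTimeSolvableOn C Correct := by
  refine ⟨c.compile d, c.cost, fun n G hG => ?_⟩
  obtain ⟨t, ⟨k, hk, r⟩, a⟩ := c.runs_compile (by omega) hc (Agree.refl d (inputState G))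
  refine ⟨k, t, r, hk, ?_⟩
  have : t.answer = (c.run (inputState G)).answer := by
    simp [State.answer, a.2 1 (by omega), a.2 2 (by omega)]
  rw [this]
  exact h n G hG

end RAM

/-! ### Minimum cuts by maximum adjacency orderings -/

namespace MinCut

open Finset

variable {α : Type*} [DecidableEq α]

/-- The weight of the cut `(S, Sᶜ)` in the weighted graph with vertex set `D` and edge
weights `W`. -/
def cut (D : Finset α) (W : α → α → ℕ) (S : Finset α) : ℕ :=
  ∑ x ∈ D, ∑ y ∈ D, if x ∈ S ∧ y ∉ S then W x y else 0

/-- The cut `(S, Sᶜ)` separates the vertices `x` and `y`. -/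
def Splits (S : Finset α) (x y : α) : Prop := ¬ (x ∈ S ↔ y ∈ S)

instance (S : Finset α) (x y : α) : Decidable (Splits S x y) :=
  inferInstanceAs (Decidable (¬ _))

theorem splits_comm {S : Finset α} {x y : α} : Splits S x y ↔ Splits S y x := by
  unfold Splits; tauto

/-- The weight of a cut after the insertion of a vertex `v`: the edges at `v` that are cut are
added. -/
theorem cut_insert {W : α → α → ℕ} (hW : ∀ x y, W x y = W y x) {D : Finset α} {v : α} (hv : v ∉ D)
    (S : Finset α) :
    cut (insert v D) W S = cut D W S + ∑ x ∈ D, if Splits S x v then W x v else 0 := by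
  simp only [cut, sum_insert hv, sum_add_distrib]
  by_cases h : v ∈ S
  · simp only [h, Splits]
    simp only [not_true_eq_false, and_false, if_false, true_and, zero_add, iff_true, sum_const_zero]
    rw [add_comm]
    congr 1
    exact sum_congr rfl fun x _ => by rw [hW]
  · simp [h, Splits, add_comm]

theorem cut_add_le {W : α → α → ℕ} (hW : ∀ x y, W x y = W y x) {D : Finset α} {u v : α}
    (hu : u ∈ D) (hv : v ∉ D) {S : Finset α} (huv : Splits S u v) :
    cut D W S + W u v ≤ cut (insert v D) W S := by
  rw [cut_insert hW hv]
  gcongr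
  have := single_le_sum (f := fun x => if Splits S x v then W x v else 0) (fun _ _ => Nat.zero_le _) hu
  simpa [huv] using this

/-- The property of the initial segments `C` of a maximum adjacency ordering of `D`, with last vertex
`cur`, on which the minimum cut search rests: every cut that separates `cur` from a vertex `v`
outside of `C` weighs, within `C ∪ {v}`, at least as much as all edges from `C` to `v` together. -/
def Segment (D : Finset α) (W : α → α → ℕ) (C : Finset α) (cur : α) : Prop :=
  ∀ S : Finset α, ∀ v ∈ D \ C, Splits S v cur → ∑ x ∈ C, W x v ≤ cut (insert v C) W S

theorem Segment.empty (D : Finset α) (W : α → α → ℕ) (cur : α) : Segment D W ∅ cur := by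
  intro S v _ _; simp

/-- A maximum adjacency ordering is continued by a vertex `v` that has the largest total weight of
edges to the vertices chosen before. -/
theorem Segment.insert {W : α → α → ℕ} (hW : ∀ x y, W x y = W y x) {D C : Finset α} {cur v : α}
    (h : Segment D W C cur) (hv : v ∈ D \ C)
    (hmax : ∀ y ∈ D \ C, ∑ x ∈ C, W x y ≤ ∑ x ∈ C, W x v) :
    Segment D W (insert v C) v := by
  intro S y hy hs
  have hvC : v ∉ C := (mem_sdiff.1 hv).2
  simp only [mem_sdiff, mem_insert, not_or] at hy
  have hyC : y ∈ D \ C := mem_sdiff.2 ⟨hy.1, hy.2.2⟩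
  rw [sum_insert hvC]
  by_cases hc : Splits S v cur
  · have h1 := (hmax y hyC).trans (h S v hv hc)
    have h2 := cut_add_le hW (mem_insert_self v C)
      (by simpa only [mem_insert, not_or] using hy.2) (splits_comm.1 hs)
    omega
  · have h1 := h S y hyC (by unfold Splits at *; tauto)
    have h2 := cut_add_le hW (u := y) (v := v) (mem_insert_self y C)
      (by simp only [mem_insert, not_or]; exact ⟨Ne.symm hy.2.1, hvC⟩) hs
    rw [Finset.insert_comm, hW y v] at h2
    omega

/-- The weights after the contraction of the classes of `lab`. -/
def contract {α β : Type*} [DecidableEq β] (D : Finset α) (lab : α → β) (w : α → α → ℕ) (x y : β) : ℕ :=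
  ∑ u ∈ D, ∑ v ∈ D, if lab u = x ∧ lab v = y then w u v else 0

theorem contract_comm {α β : Type*} [DecidableEq β] {D : Finset α} {lab : α → β}
    {w : α → α → ℕ} (hw : ∀ x y, w x y = w y x)
    (x y : β) : contract D lab w x y = contract D lab w y x := by
  unfold contract
  rw [sum_comm]
  refine sum_congr rfl fun u _ => sum_congr rfl fun v _ => ?_
  rw [hw v u]
  simp only [and_comm]

theorem sum_contract {α β : Type*} [DecidableEq β] {D : Finset α} {lab : α → β}
    {w : α → α → ℕ} (C : Finset β) (y : β) :
    ∑ x ∈ C, contract D lab w x y =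
      ∑ u ∈ D, ∑ v ∈ D, if lab u ∈ C ∧ lab v = y then w u v else 0 := by
  unfold contract
  rw [sum_comm]
  refine sum_congr rfl fun u _ => ?_
  rw [sum_comm]
  refine sum_congr rfl fun v _ => ?_
  by_cases h : lab v = y
  · simp [h]
  · simp [h]

/-- A cut of `D` that does not separate vertices of the same class is a cut of the contracted
graph. -/
theorem cut_contract {D R : Finset α} {lab : α → α} {w : α → α → ℕ} {S : Finset α}
    (hR : ∀ u ∈ D, lab u ∈ R) (hS : ∀ u ∈ D, (lab u ∈ S ↔ u ∈ S)) :
    cut R (contract D lab w) S = cut D w S := by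
  have h1 : ∀ x y, (if x ∈ S ∧ y ∉ S then contract D lab w x y else 0) =
      ∑ u ∈ D, ∑ v ∈ D, if lab u = x ∧ lab v = y then
        (if lab u ∈ S ∧ lab v ∉ S then w u v else 0) else 0 := by
    intro x y
    unfold contract
    split_ifs with h
    · refine sum_congr rfl fun u _ => sum_congr rfl fun v _ => ?_
      by_cases h' : lab u = x ∧ lab v = y
      · rw [if_pos h', if_pos h', h'.1, h'.2, if_pos h]
      · rw [if_neg h', if_neg h']
    · symm
      refine sum_eq_zero fun u _ => sum_eq_zero fun v _ => ?_
      by_cases h' : lab u = x ∧ lab v = y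
      · rw [if_pos h', h'.1, h'.2, if_neg h]
      · rw [if_neg h']
  unfold cut
  simp only [h1]
  have h2 : ∀ x, ∑ y ∈ R, ∑ u ∈ D, ∑ v ∈ D, (if lab u = x ∧ lab v = y then
        (if lab u ∈ S ∧ lab v ∉ S then w u v else 0) else 0) =
      ∑ u ∈ D, if lab u = x then
        ∑ v ∈ D, (if lab u ∈ S ∧ lab v ∉ S then w u v else 0) else 0 := by
    intro x
    rw [sum_comm]
    refine sum_congr rfl fun u _ => ?_
    rw [sum_comm]
    by_cases h : lab u = x
    · simp only [h, true_and, if_true]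
      refine sum_congr rfl fun v hv => ?_
      rw [sum_ite_eq, if_pos (hR v hv)]
    · simp [h]
  simp only [h2]
  rw [sum_comm]
  refine sum_congr rfl fun u hu => ?_
  rw [sum_ite_eq, if_pos (hR u hu)]
  refine sum_congr rfl fun v hv => ?_
  simp only [hS u hu, hS v hv]

/-- Both sides of the cut `(S, Sᶜ)` of `D` are non-empty. -/
def Proper (D S : Finset α) : Prop := (∃ u ∈ D, u ∈ S) ∧ ∃ v ∈ D, v ∉ S

/-- The state of the minimum cut search between two phases: `lab` maps every vertex to the
representative of its class, and every proper cut that weighs less than `best` respects the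
classes. Here `best` is the weight of the best cut found so far, and `big` if there is none. -/
structure Progress (D : Finset α) (w : α → α → ℕ) (big : ℕ) (lab : α → α) (best : ℕ) : Prop where
  lab_mem : ∀ v ∈ D, lab v ∈ D
  lab_lab : ∀ v ∈ D, lab (lab v) = lab v
  best_le : best ≤ big
  attained : best = big ∨ ∃ S, Proper D S ∧ cut D w S = best
  complete : ∀ S, Proper D S → best ≤ cut D w S ∨ ∀ u ∈ D, (lab u ∈ S ↔ u ∈ S)

/-- The representatives of the classes of `lab`. -/
def reps (D : Finset α) (lab : α → α) : Finset α := {v ∈ D | lab v = v}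

theorem Progress.init {D : Finset α} {w : α → α → ℕ} {big : ℕ} {lab : α → α}
    (h : ∀ v ∈ D, lab v = v) : Progress D w big lab big where
  lab_mem v hv := by rwa [h v hv]
  lab_lab v hv := by rw [h v hv, h v hv]
  best_le := le_rfl
  attained := .inl rfl
  complete S _ := .inr fun u hu => by rw [h u hu]

/-- The cut that a maximum adjacency ordering of the classes ends with. -/
theorem cut_class {D : Finset α} {w : α → α → ℕ} (hw : ∀ x y, w x y = w y x) {lab : α → α}
    (hmem : ∀ v ∈ D, lab v ∈ D) (hlab : ∀ v ∈ D, lab (lab v) = lab v) {t : α} :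
    cut D w {v ∈ D | lab v = t} = ∑ x ∈ (reps D lab).erase t, contract D lab w x t := by
  rw [sum_contract]
  unfold cut
  rw [sum_comm]
  refine sum_congr rfl fun u hu => sum_congr rfl fun v hv => ?_
  rw [hw v u]
  have := hlab u hu
  have := hmem u hu
  simp only [mem_filter, true_and, mem_erase, reps, *, and_true]
  exact if_congr (by tauto) rfl rfl

/-- One phase: if `s` and `t` are the last two vertices of a maximum adjacency ordering of the
classes, then the lightest cut that separates them separates the class of `t` from all others, so
that it can be recorded and the two classes can be merged. -/
theorem Progress.merge {D : Finset α} {w : α → α → ℕ} (hw : ∀ x y, w x y = w y x) {big : ℕ}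
    {lab lab' : α → α} {best : ℕ} (h : Progress D w big lab best) {s t : α}
    (hs : s ∈ reps D lab) (ht : t ∈ reps D lab) (hst : s ≠ t)
    (hseg : ∀ S, Splits S s t →
      ∑ x ∈ (reps D lab).erase t, contract D lab w x t ≤ cut (reps D lab) (contract D lab w) S)
    (hlab' : ∀ v ∈ D, lab' v = if lab v = t then s else lab v) :
    Progress D w big lab' (min (∑ x ∈ (reps D lab).erase t, contract D lab w x t) best) ∧
      #(reps D lab') + 1 = #(reps D lab) := by
  have hs' := mem_filter.1 hs
  have ht' := mem_filter.1 ht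
  refine ⟨⟨?_, ?_, (min_le_right _ _).trans h.best_le, ?_, ?_⟩, ?_⟩
  · intro v hv
    rw [hlab' v hv]
    split_ifs
    exacts [hs'.1, h.lab_mem v hv]
  · intro v hv
    rw [hlab' v hv]
    split_ifs with h1
    · rw [hlab' s hs'.1, hs'.2, if_neg hst]
    · rw [hlab' _ (h.lab_mem v hv), h.lab_lab v hv, if_neg h1]
  · rcases min_choice (∑ x ∈ (reps D lab).erase t, contract D lab w x t) best with h1 | h1
    · refine .inr ⟨{v ∈ D | lab v = t}, ⟨⟨t, ht'.1, mem_filter.2 ht'⟩, s, hs'.1, ?_⟩, ?_⟩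
      · simp [hs'.2, hst]
      · rw [h1, cut_class hw h.lab_mem h.lab_lab]
    · rw [h1]; exact h.attained
  · intro S hS
    rcases h.complete S hS with h1 | h1
    · exact .inl ((min_le_right _ _).trans h1)
    · by_cases h2 : Splits S s t
      · left
        refine (min_le_left _ _).trans ((hseg S h2).trans_eq (cut_contract (fun u hu => ?_) h1))
        exact mem_filter.2 ⟨h.lab_mem u hu, h.lab_lab u hu⟩
      · right
        intro u hu
        rw [hlab' u hu]
        split_ifs with h3
        · rw [← h1 u hu, h3]
          unfold Splits at h2; tauto
        · exact h1 u hu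
  · have : reps D lab' = (reps D lab).erase t := by
      ext v
      simp only [reps, mem_filter, mem_erase]
      constructor
      · rintro ⟨hv, h1⟩
        rw [hlab' v hv] at h1
        split_ifs at h1 with h2
        · subst h1; exact absurd (hs'.2.symm.trans h2) hst
        · exact ⟨fun e => h2 (by rw [h1, e]), hv, h1⟩
      · rintro ⟨h1, hv, h2⟩
        exact ⟨hv, by rw [hlab' v hv, h2, if_neg h1]⟩
    rw [this, card_erase_add_one ht]

/-- When all vertices are in one class, the search is complete. -/
theorem Progress.le_cut {D : Finset α} {w : α → α → ℕ} {big : ℕ} {lab : α → α} {best : ℕ}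
    (h : Progress D w big lab best) (hR : #(reps D lab) ≤ 1) {S : Finset α} (hS : Proper D S) :
    best ≤ cut D w S := by
  rcases h.complete S hS with h1 | h1
  · exact h1
  · obtain ⟨⟨u, hu, huS⟩, v, hv, hvS⟩ := hS
    have hrep : ∀ x ∈ D, lab x ∈ reps D lab := fun x hx =>
      mem_filter.2 ⟨h.lab_mem x hx, h.lab_lab x hx⟩
    have := card_le_one.1 hR _ (hrep u hu) _ (hrep v hv)
    rw [← h1 u hu, this, h1 v hv] at huS
    exact absurd huS hvS

end MinCut

/-! ### Matching cuts of claw-free graphs as cuts of a weighted graph -/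

namespace MatchingCut

open Finset MinCut

variable {α : Type*}

/-- `G` has no claw, stated for the center `a` and the leaves `b`, `c` and `d`. -/
def NoClaw (G : SimpleGraph α) : Prop :=
  ∀ a b c d, G.Adj a b → G.Adj a c → G.Adj a d → b ≠ c → b ≠ d → c ≠ d →
    G.Adj b c ∨ G.Adj b d ∨ G.Adj c d

/-- The edge `uv` lies in no triangle of `G`. -/
def Good (G : SimpleGraph α) (u v : α) : Prop :=
  G.Adj u v ∧ ¬ ∃ x, G.Adj u x ∧ G.Adj v x

/-- Some edge that lies in no triangle joins two vertices which both have a further edge that lies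
in no triangle. -/
def Flagged (G : SimpleGraph α) : Prop :=
  ∃ u v, Good G u v ∧ (∃ x, x ≠ v ∧ Good G u x) ∧ ∃ y, y ≠ u ∧ Good G v y

/-- No vertex has two neighbors on the other side of the cut `(S, Sᶜ)`. -/
def Matching [DecidableEq α] (G : SimpleGraph α) (S : Finset α) : Prop :=
  ∀ u v x, G.Adj u v → G.Adj u x → Splits S u v → Splits S u x → v = x

open Classical in
/-- The adjacency matrix. -/
noncomputable def adjInd (G : SimpleGraph α) (u v : α) : ℕ := if G.Adj u v then 1 else 0

theorem Good.symm {G : SimpleGraph α} {u v : α} (h : Good G u v) : Good G v u :=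
  ⟨h.1.symm, fun ⟨x, h1, h2⟩ => h.2 ⟨x, h2, h1⟩⟩

theorem adjInd_comm (G : SimpleGraph α) (u v : α) : adjInd G u v = adjInd G v u := by
  classical
  unfold adjInd
  exact if_congr (G.adj_comm u v) rfl rfl

/-- In a claw-free graph, a vertex with two edges that lie in no triangle has no other edges. -/
theorem NoClaw.eq_or_eq {G : SimpleGraph α} (hG : NoClaw G) {u v x y : α} (hv : Good G u v)
    (hx : Good G u x) (hvx : v ≠ x) (hy : G.Adj u y) : y = v ∨ y = x := by
  by_contra! h
  rcases hG u v x y hv.1 hx.1 hy hvx h.1.symm h.2.symm with h1 | h1 | h1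
  · exact hv.2 ⟨x, hx.1, h1⟩
  · exact hv.2 ⟨y, hy, h1⟩
  · exact hx.2 ⟨y, hy, h1⟩

section Cut

variable [DecidableEq α]

/-- The edges of a matching cut lie in no triangle. -/
theorem Matching.good {G : SimpleGraph α} {S : Finset α} (h : Matching G S) {u v : α}
    (huv : G.Adj u v) (hs : Splits S u v) : Good G u v := by
  refine ⟨huv, fun ⟨x, hu, hv⟩ => ?_⟩
  by_cases hx : Splits S u x
  · have := h u v x huv hu hs hx
    subst this
    exact hv.ne rfl
  · have := h v u x huv.symm hv (splits_comm.1 hs) (by unfold Splits at *; tauto)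
    subst this
    exact hu.ne rfl

theorem le_cut {D : Finset α} {W : α → α → ℕ} (hW : ∀ x y, W x y = W y x) {S : Finset α} {u v : α}
    (hu : u ∈ D) (hv : v ∈ D) (hs : Splits S u v) : W u v ≤ cut D W S := by
  have key : ∀ a ∈ D, ∀ b ∈ D, a ∈ S → b ∉ S → W a b ≤ cut D W S := by
    intro a ha b hb haS hbS
    have h1 := single_le_sum (f := fun y => if a ∈ S ∧ y ∉ S then W a y else 0)
      (fun _ _ => Nat.zero_le _) hb
    have h2 := single_le_sum (f := fun x => ∑ y ∈ D, if x ∈ S ∧ y ∉ S then W x y else 0)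
      (fun _ _ => Nat.zero_le _) ha
    simp only [haS, hbS, not_false_eq_true, and_self, if_true] at h1
    exact h1.trans (by simpa [haS, cut] using h2)
  by_cases h : u ∈ S
  · exact key u hu v hv h (by unfold Splits at hs; tauto)
  · rw [hW]; exact key v hv u hu (by unfold Splits at hs; tauto) h

theorem cut_congr {D : Finset α} {W W' : α → α → ℕ} {S S' : Finset α}
    (hS : ∀ x ∈ D, (x ∈ S ↔ x ∈ S'))
    (hW : ∀ x ∈ D, ∀ y ∈ D, Splits S x y → W x y = W' x y) : cut D W S = cut D W' S' := by
  unfold cut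
  refine sum_congr rfl fun x hx => sum_congr rfl fun y hy => ?_
  simp only [← hS x hx, ← hS y hy]
  split_ifs with h
  · exact hW x hx y hy (by unfold Splits; tauto)
  · rfl

theorem proper_of_sep {D S : Finset α} {u v : α} (hu : u ∈ D) (hv : v ∈ D) (h : Splits S u v) :
    Proper D S := by
  by_cases hS : u ∈ S
  · exact ⟨⟨u, hu, hS⟩, v, hv, by unfold Splits at h; tauto⟩
  · exact ⟨⟨v, hv, by unfold Splits at h; tauto⟩, u, hu, hS⟩

open Classical in
theorem cut_adjInd (D : Finset α) (G : SimpleGraph α) (S : Finset α) :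
    cut D (adjInd G) S = #{p ∈ D ×ˢ D | (p.1 ∈ S ∧ p.2 ∉ S) ∧ G.Adj p.1 p.2} := by
  rw [card_filter, sum_product]
  unfold cut adjInd
  refine sum_congr rfl fun x _ => sum_congr rfl fun y _ => ?_
  rw [← ite_and]

/-- A cut with at most one edge is a matching cut. -/
theorem matching_of_cut_le_one {D : Finset α} {G : SimpleGraph α} (hD : ∀ u v, G.Adj u v → u ∈ D)
    {S : Finset α} (h : cut D (adjInd G) S ≤ 1) : Matching G S := by
  classical
  intro u v x hv hx hsv hsx
  rw [cut_adjInd, card_le_one] at h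
  unfold Splits at hsv hsx
  have m : ∀ {a b}, G.Adj a b → a ∈ S → b ∉ S →
      (a, b) ∈ {p ∈ D ×ˢ D | (p.1 ∈ S ∧ p.2 ∉ S) ∧ G.Adj p.1 p.2} := fun hab ha hb =>
    mem_filter.2 ⟨mem_product.2 ⟨hD _ _ hab, hD _ _ hab.symm⟩, ⟨ha, hb⟩, hab⟩
  by_cases hu : u ∈ S
  · exact congrArg Prod.snd (h _ (m hv hu (by tauto)) _ (m hx hu (by tauto)))
  · exact congrArg Prod.fst (h _ (m hv.symm (by tauto) hu) _ (m hx.symm (by tauto) hu))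

/-- The two ends of the edge in `Flagged` form one side of a matching cut with two edges. -/
theorem Flagged.exists_matching {D : Finset α} {G : SimpleGraph α} (hD : ∀ u v, G.Adj u v → u ∈ D)
    (hG : NoClaw G) (h : Flagged G) :
    ∃ S, Proper D S ∧ Matching G S ∧ cut D (adjInd G) S ≤ 2 := by
  classical
  obtain ⟨u, v, huv, ⟨x, hxv, hux⟩, y, hyu, hvy⟩ := h
  have hu := fun z => hG.eq_or_eq (y := z) huv hux hxv.symm
  have hv := fun z => hG.eq_or_eq (y := z) huv.symm hvy hyu.symm
  have hxu : x ≠ u := hux.1.ne'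
  have hyv : y ≠ v := hvy.1.ne'
  have huv' : u ≠ v := huv.1.ne
  have hxy : x ≠ y := fun e => huv.2 ⟨x, hux.1, e ▸ hvy.1⟩
  refine ⟨{u, v}, ⟨⟨u, hD _ _ huv.1, by simp⟩, x, hD _ _ hux.1.symm, by simp [hxu, hxv]⟩, ?_, ?_⟩
  · intro a b c hab hac hsb hsc
    simp only [Splits, mem_insert, mem_singleton] at hsb hsc
    by_cases hau : a = u
    · subst hau
      have := hu b hab
      have := hu c hac
      grind
    · by_cases hav : a = v
      · subst hav
        have := hv b hab
        have := hv c hac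
        grind
      · have h1 : b = u ∨ b = v := by tauto
        have h2 : c = u ∨ c = v := by tauto
        rcases h1 with rfl | rfl <;> rcases h2 with rfl | rfl
        · rfl
        · have := hu a hab.symm; have := hv a hac.symm; grind
        · have := hv a hab.symm; have := hu a hac.symm; grind
        · rfl
  · rw [cut_adjInd]
    refine (card_le_card (t := {(u, x), (v, y)}) ?_).trans card_le_two
    rintro ⟨a, b⟩ hp
    simp only [mem_filter, mem_insert, mem_singleton, not_or, Prod.mk.injEq] at hp ⊢
    obtain ⟨-, ⟨h1, h2⟩, h3⟩ := hp
    rcases h1 with rfl | rfl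
    · exact .inl ⟨rfl, (hu b h3).resolve_left h2.2⟩
    · exact .inr ⟨rfl, (hv b h3).resolve_left h2.1⟩

/-- The effect of moving a vertex `u` of degree two to the other side, when its neighbor `v` is
on the other side and its neighbor `x` is not. -/
theorem cut_flip {D : Finset α} {G : SimpleGraph α} {W : α → α → ℕ} (hW : ∀ a b, W a b = W b a)
    (hWG : ∀ a b, ¬ G.Adj a b → W a b = 0) {S S' : Finset α} {u v x : α} (hu : u ∈ D) (hv : v ∈ D)
    (hx : x ∈ D) (hvu : v ≠ u) (hxu : x ≠ u) (hN : ∀ y, G.Adj u y → y = v ∨ y = x)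
    (hsv : Splits S u v) (hsx : ¬ Splits S u x) (hS' : ∀ y, y ∈ S' ↔ if y = u then u ∉ S else y ∈ S) :
    cut D W S + W u x = cut D W S' + W u v := by
  have aux : ∀ T : Finset α, ∀ a b, a ∈ D → a ≠ u → Splits T u a → ¬ Splits T u b →
      (∀ y, G.Adj u y → y = a ∨ y = b) →
      cut D W T = cut (D.erase u) W T + W u a := by
    intro T a b ha hau hsa hsb hab
    conv_lhs => rw [← insert_erase hu, cut_insert hW (notMem_erase u D)]
    congr 1
    rw [sum_eq_single a, if_pos (splits_comm.1 hsa), hW]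
    · intro y _ hya
      split_ifs with hsy
      · rw [hW]
        refine hWG _ _ fun h => ?_
        rcases hab y h with rfl | rfl
        exacts [hya rfl, hsb (splits_comm.1 hsy)]
      · rfl
    · exact fun h => absurd (mem_erase.2 ⟨hau, ha⟩) h
  rw [aux S v x hv hvu hsv hsx hN, aux S' x v hx hxu
    (by simp only [Splits, hS', if_true, if_neg hxu] at hsv hsx ⊢; tauto)
    (by simp only [Splits, hS', if_true, if_neg hvu] at hsv hsx ⊢; tauto) fun y hy => (hN y hy).symm,
    cut_congr (S' := S') (fun y hy => by rw [hS', if_neg (mem_erase.1 hy).1]) fun _ _ _ _ _ => rfl]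
  ring

end Cut

variable [LinearOrder α]

/-- The edges that are not allowed in a cut: those in triangles and, at every vertex with two edges
that lie in no triangle, the one to the smaller neighbor. -/
def Heavy (G : SimpleGraph α) (u v : α) : Prop :=
  G.Adj u v ∧ (¬ Good G u v ∨ (∃ x, v < x ∧ Good G u x) ∨ ∃ x, u < x ∧ Good G v x)

theorem Heavy.symm {G : SimpleGraph α} {u v : α} (h : Heavy G u v) : Heavy G v u := by
  refine ⟨h.1.symm, ?_⟩
  rcases h.2 with h | h | h
  · exact .inl fun h' => h h'.symm
  · exact .inr (.inr h)
  · exact .inr (.inl h)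

open Classical in
/-- The edge weights for the minimum cut search: the weight `big` stands for infinity. -/
noncomputable def weight (G : SimpleGraph α) (big : ℕ) (u v : α) : ℕ :=
  if ¬ Flagged G ∧ Heavy G u v then big else adjInd G u v

theorem weight_comm (G : SimpleGraph α) (big : ℕ) (u v : α) :
    weight G big u v = weight G big v u := by
  have : Heavy G u v ↔ Heavy G v u := ⟨Heavy.symm, Heavy.symm⟩
  classical
  unfold weight
  rw [adjInd_comm G u v]
  exact if_congr (and_congr_right fun _ => this) rfl rfl

theorem weight_of_not_heavy {G : SimpleGraph α} {big : ℕ} {u v : α} (h : ¬ Heavy G u v) :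
    weight G big u v = adjInd G u v := if_neg fun h' => h h'.2

/-- A cut that is lighter than `big` is a matching cut. -/
theorem matching_of_cut_lt {D : Finset α} {G : SimpleGraph α} (hD : ∀ u v, G.Adj u v → u ∈ D)
    (hF : ¬ Flagged G) {big : ℕ} {S : Finset α} (h : cut D (weight G big) S < big) :
    Matching G S ∧ cut D (weight G big) S = cut D (adjInd G) S := by
  have key : ∀ u ∈ D, ∀ v ∈ D, Splits S u v → ¬ Heavy G u v := by
    intro u hu v hv hs hh
    have := le_cut (weight_comm G big) hu hv hs
    rw [weight, if_pos ⟨hF, hh⟩] at this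
    omega
  refine ⟨fun u v x hv hx hsv hsx => ?_, cut_congr (fun _ _ => Iff.rfl) fun u hu v hv hs =>
    weight_of_not_heavy (key u hu v hv hs)⟩
  have h1 := key u (hD _ _ hv) v (hD _ _ hv.symm) hsv
  have h2 := key u (hD _ _ hx) x (hD _ _ hx.symm) hsx
  simp only [Heavy, hv, hx, true_and, not_or, not_not, not_exists, not_and] at h1 h2
  rcases lt_trichotomy v x with h | h | h
  · exact absurd h2.1 (h1.2.1 x h)
  · exact h
  · exact absurd h1.1 (h2.2.1 v h)

/-- Every matching cut can be turned into a cut without heavy edges that has as many edges: as long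
as it contains a heavy edge, one of the ends of this edge has degree two and can be moved to the
other side, which decreases the weight of the cut. -/
theorem Matching.exists_cut_le {D : Finset α} {G : SimpleGraph α} (hD : ∀ u v, G.Adj u v → u ∈ D)
    (hG : NoClaw G) (hF : ¬ Flagged G) {big : ℕ} (hbig : 1 < big) {S : Finset α}
    (hS : Proper D S) (hM : Matching G S) :
    ∃ S', Proper D S' ∧ cut D (weight G big) S' ≤ cut D (adjInd G) S := by
  induction hk : cut D (weight G big) S using Nat.strong_induction_on generalizing S with
  | _ k ih =>
    subst hk
    by_cases hh : ∃ u v, Splits S u v ∧ Heavy G u v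
    swap
    · push Not at hh
      exact ⟨S, hS, (cut_congr (fun _ _ => Iff.rfl) fun u _ v _ hs =>
        weight_of_not_heavy (hh u v hs)).le⟩
    obtain ⟨u, v, x, hs, hv, hvx, hx⟩ :
        ∃ u v x, Splits S u v ∧ Good G u v ∧ v < x ∧ Good G u x := by
      obtain ⟨u, v, hs, ha, hh | ⟨x, h1, h2⟩ | ⟨x, h1, h2⟩⟩ := hh
      · exact absurd (hM.good ha hs) hh
      · exact ⟨u, v, x, hs, hM.good ha hs, h1, h2⟩
      · exact ⟨v, u, x, splits_comm.1 hs, (hM.good ha hs).symm, h1, h2⟩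
    have hN := fun y => hG.eq_or_eq (y := y) hv hx hvx.ne
    have hsx : ¬ Splits S u x := fun h => hvx.ne (hM u v x hv.1 hx.1 hs h)
    have hvu : v ≠ u := hv.1.ne'
    have hxu : x ≠ u := hx.1.ne'
    have huD : u ∈ D := hD _ _ hv.1
    have hvD : v ∈ D := hD _ _ hv.1.symm
    have hxD : x ∈ D := hD _ _ hx.1.symm
    -- `S'` is `S` with `u` moved to the other side.
    obtain ⟨S', hS'⟩ : ∃ S' : Finset α, ∀ y, y ∈ S' ↔ if y = u then u ∉ S else y ∈ S := by
      by_cases h : u ∈ S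
      · exact ⟨S.erase u, fun y => by by_cases hy : y = u <;> simp [hy, h]⟩
      · exact ⟨insert u S, fun y => by by_cases hy : y = u <;> simp [hy, h]⟩
    -- Apart from `ux`, every edge at `x` lies in a triangle, as otherwise `G` would be flagged.
    have hxy : ∀ y, y ≠ u → ¬ Good G x y := fun y hy hg =>
      hF ⟨u, x, hx, ⟨v, hvx.ne, hv⟩, y, hy, hg⟩
    have hsv' : ¬ Splits S' u v := by
      simp only [Splits, hS', if_true, if_neg hvu] at hs hsx ⊢; tauto
    have hsx' : Splits S' u x := by
      simp only [Splits, hS', if_true, if_neg hxu] at hs hsx ⊢; tauto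
    have hsep : ∀ a b, a ≠ u → b ≠ u → (Splits S' a b ↔ Splits S a b) := by
      intro a b ha hb
      simp only [Splits, hS', if_neg ha, if_neg hb]
    have hM' : Matching G S' := by
      intro a b c hab hac hsb hsc
      by_cases hau : a = u
      · subst hau
        have e : ∀ z, G.Adj a z → Splits S' a z → z = x := fun z hz hsz =>
          (hN z hz).resolve_left fun h => hsv' (h ▸ hsz)
        rw [e b hab hsb, e c hac hsc]
      · have e : ∀ z, G.Adj a z → Splits S' a z → G.Adj a u → Splits S' a u → z = u := by
          intro z hz hsz hu hsu
          have hax : a = x := (hN a hu.symm).resolve_left fun h => hsv' (h ▸ splits_comm.1 hsu)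
          subst hax
          by_contra hzu
          exact hxy z hzu (hM.good hz ((hsep _ _ hau hzu).1 hsz))
        by_cases hbu : b = u
        · subst hbu; exact (e c hac hsc hab hsb).symm
        · by_cases hcu : c = u
          · subst hcu; exact e b hab hsb hac hsc
          · exact hM a b c hab hac ((hsep _ _ hau hbu).1 hsb) ((hsep _ _ hau hcu).1 hsc)
    have hlight : ¬ Heavy G u x := by
      rintro ⟨-, h | ⟨y, h1, h2⟩ | ⟨y, h1, h2⟩⟩
      · exact h hx
      · rcases hN y h2.1 with rfl | rfl
        · exact lt_asymm h1 hvx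
        · exact lt_irrefl _ h1
      · exact hxy y h1.ne' h2
    have f1 := cut_flip (weight_comm G big) (G := G) (fun a b h => by
      rw [weight_of_not_heavy fun h' => h h'.1, adjInd, if_neg h]) huD hvD hxD hvu hxu hN hs hsx hS'
    have f2 := cut_flip (adjInd_comm G) (G := G) (fun a b h => by rw [adjInd, if_neg h])
      huD hvD hxD hvu hxu hN hs hsx hS'
    have hheavy : Heavy G u v := ⟨hv.1, .inr (.inl ⟨x, hvx, hx⟩)⟩
    rw [weight_of_not_heavy hlight, weight, if_pos ⟨hF, hheavy⟩, adjInd, if_pos hx.1] at f1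
    rw [adjInd, adjInd, if_pos hx.1, if_pos hv.1] at f2
    obtain ⟨S'', h1, h2⟩ := ih _ (by omega) (proper_of_sep huD hxD hsx') hM' rfl
    exact ⟨S'', h1, by omega⟩

/-- The sizes of the matching cuts. -/
def sizes (D : Finset α) (G : SimpleGraph α) : Set ℕ :=
  {k | ∃ S, Proper D S ∧ Matching G S ∧ cut D (adjInd G) S = k}

open Classical in
/-- The size of a minimum matching cut, computed from the weight `best` of a minimum cut. -/
theorem isLeast_sizes {D : Finset α} {G : SimpleGraph α} (hD : ∀ u v, G.Adj u v → u ∈ D)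
    (hG : NoClaw G) {big best : ℕ} (hbig : 1 < big) (hcut : ∀ S, cut D (adjInd G) S < big)
    (hatt : best = big ∨ ∃ S, Proper D S ∧ cut D (weight G big) S = best)
    (hmin : ∀ S, Proper D S → best ≤ cut D (weight G big) S) :
    (best < big → IsLeast (sizes D G) (if Flagged G then min best 2 else best)) ∧
      (big ≤ best → sizes D G = ∅) := by
  by_cases hF : Flagged G
  · have hw : weight G big = adjInd G := by
      funext u v; exact if_neg fun h => h.1 hF
    rw [hw] at hatt hmin
    obtain ⟨S₂, hp, hm, hc⟩ := hF.exists_matching hD hG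
    have hlt := (hmin S₂ hp).trans_lt (hcut S₂)
    refine ⟨fun _ => ?_, fun h => absurd hlt h.not_gt⟩
    rw [if_pos hF]
    constructor
    · by_cases hb : best ≤ 1
      · obtain ⟨S, hS, rfl⟩ := hatt.resolve_left hlt.ne
        exact ⟨S, hS, matching_of_cut_le_one hD hb, by omega⟩
      · exact ⟨S₂, hp, hm, by have := hmin S₂ hp; omega⟩
    · rintro k ⟨S, hS, -, rfl⟩
      exact (min_le_left _ _).trans (hmin S hS)
  · rw [if_neg hF]
    refine ⟨fun hlt => ⟨?_, ?_⟩, fun h => Set.eq_empty_iff_forall_notMem.2 ?_⟩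
    · obtain ⟨S, hS, rfl⟩ := hatt.resolve_left hlt.ne
      obtain ⟨h1, h2⟩ := matching_of_cut_lt hD hF hlt
      exact ⟨S, hS, h1, h2.symm⟩
    · rintro k ⟨S, hS, hM, rfl⟩
      obtain ⟨S', h1, h2⟩ := hM.exists_cut_le hD hG hF hbig hS
      exact (hmin S' h1).trans h2
    · rintro k ⟨S, hS, hM, rfl⟩
      obtain ⟨S', h1, h2⟩ := hM.exists_cut_le hD hG hF hbig hS
      have := hmin S' h1
      have := hcut S
      omega

end MatchingCut

/-! ### The algorithm and its correctness -/

namespace RAM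

open Finset MinCut MatchingCut

-- The layout of the memory. The registers `rU`, `rV`, `rX`, `rRow` and `rY` occur only as bound
-- variables of sums; `rI`, `rStep` and `rPhase` are the loop counters.
local notation "rN" => (0 : ℕ)
local notation "rFound" => (1 : ℕ)
local notation "rAnswer" => (2 : ℕ)
local notation "rU" => (3 : ℕ)
local notation "rV" => (4 : ℕ)
local notation "rX" => (5 : ℕ)
local notation "rRow" => (6 : ℕ)
local notation "rY" => (7 : ℕ)
local notation "rBest" => (8 : ℕ)
local notation "rI" => (9 : ℕ)
local notation "rMax" => (10 : ℕ)
local notation "rSel" => (11 : ℕ)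
local notation "rPrev" => (12 : ℕ)
local notation "rCur" => (13 : ℕ)
local notation "rKey" => (14 : ℕ)
local notation "rStep" => (15 : ℕ)
local notation "rPhase" => (16 : ℕ)
local notation "aAdj" => (0 : ℕ)
local notation "aLab" => (1 : ℕ)
local notation "aChosen" => (2 : ℕ)

namespace Expr

/-- Conjunction; expressions serve as truth values, with `0` as the only false one. -/
def and (a b : Expr) : Expr := cond a b (const 0)

/-- Negation. -/
def not (a : Expr) : Expr := sub (const 1) a

/-- The test `a < b`. -/
def lt (a b : Expr) : Expr := sub b a

/-- The test `a ≠ b`. -/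
def ne (a b : Expr) : Expr := add (sub a b) (sub b a)

theorem and_eval (a b : Expr) (s : State) :
    (and a b).eval s ≠ 0 ↔ a.eval s ≠ 0 ∧ b.eval s ≠ 0 := by
  simp [and]

theorem not_eval (a : Expr) (s : State) : (not a).eval s ≠ 0 ↔ ¬ a.eval s ≠ 0 := by
  simp only [not, eval]; omega

theorem add_eval (a b : Expr) (s : State) :
    (add a b).eval s ≠ 0 ↔ a.eval s ≠ 0 ∨ b.eval s ≠ 0 := by
  simp only [eval]; omega

theorem lt_eval (a b : Expr) (s : State) : (lt a b).eval s ≠ 0 ↔ a.eval s < b.eval s := by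
  simp only [lt, eval]; omega

theorem ne_eval (a b : Expr) (s : State) : (ne a b).eval s ≠ 0 ↔ a.eval s ≠ b.eval s := by
  simp only [ne, eval]; omega

theorem sum_eval (x : ℕ) (e : Expr) (s : State) :
    (sum x e).eval s ≠ 0 ↔ ∃ k < s.reg 0, e.eval (s.setReg x k) ≠ 0 := by
  simp [Finset.sum_eq_zero_iff]

end Expr

open RAM.Expr

/-- The memory contains the input graph `G`. -/
structure Holds {n : ℕ} (G : SimpleGraph (Fin n)) (s : State) : Prop where
  reg : s.reg rN = n
  arr : s.arr aAdj = (inputState G).arr aAdj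

theorem Holds.setReg {n : ℕ} {G : SimpleGraph (Fin n)} {s : State} (h : Holds G s) {x v : ℕ}
    (hx : x ≠ 0) : Holds G (s.setReg x v) :=
  ⟨by simp [hx.symm, h.reg], h.arr⟩

theorem Holds.run {n : ℕ} {G : SimpleGraph (Fin n)} {s : State} (h : Holds G s) {c : Cmd}
    (h0 : c.writesReg rN = false) (h1 : c.writesArr aAdj = false) : Holds G (c.run s) :=
  ⟨by rw [Cmd.run_reg h0, h.reg], by rw [Cmd.run_arr h1, h.arr]⟩

/-- The input graph as a graph on the natural numbers, with isolated vertices from `n` on. -/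
def natGraph {n : ℕ} (G : SimpleGraph (Fin n)) : SimpleGraph ℕ := G.map Fin.valEmbedding

theorem natGraph_adj {n : ℕ} {G : SimpleGraph (Fin n)} {u v : ℕ} :
    (natGraph G).Adj u v ↔ ∃ (hu : u < n) (hv : v < n), G.Adj ⟨u, hu⟩ ⟨v, hv⟩ := by
  simp only [natGraph, Fin.valEmbedding_apply]
  constructor
  · rintro ⟨-, a, b, h, rfl, rfl⟩; exact ⟨a.2, b.2, h⟩
  · rintro ⟨hu, hv, h⟩
    exact ⟨fun e => h.ne (by simp [e]), _, _, h, rfl, rfl⟩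

theorem natGraph_lt {n : ℕ} {G : SimpleGraph (Fin n)} {u v : ℕ} (h : (natGraph G).Adj u v) :
    u < n := (natGraph_adj.1 h).1

/-- The adjacency matrix in the initial memory; the position `n * u + v` determines `u` and `v`, as
`v < n`. -/
theorem inputState_arr {n : ℕ} (G : SimpleGraph (Fin n)) {u v : ℕ} (hv : v < n) :
    (inputState G).arr aAdj (n * u + v) = adjInd (natGraph G) u v := by
  classical
  simp only [inputState, adjInd, true_and]
  refine if_congr ?_ rfl rfl
  rw [natGraph_adj]
  constructor
  · rintro ⟨a, b, h, hab⟩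
    have hn : 0 < n := by omega
    have h1 : v = b := by
      have := congrArg (· % n) h
      simpa [Nat.mul_add_mod, Nat.mul_comm _ n, Nat.mod_eq_of_lt hv, Nat.mod_eq_of_lt b.2] using this
    have h2 : u = a := by
      subst h1
      have h3 : n * u = n * a := by rw [Nat.mul_comm (a : ℕ)] at h; omega
      exact Nat.eq_of_mul_eq_mul_left hn h3
    subst h1 h2
    exact ⟨a.2, b.2, hab⟩
  · rintro ⟨hu, hv, h⟩
    exact ⟨⟨u, hu⟩, ⟨v, hv⟩, by rw [Nat.mul_comm], h⟩

/-- The entry of the adjacency matrix for the vertices in the registers `u` and `v`. The row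
offset, a product, is computed as a sum. -/
def adjE (u v : ℕ) : Expr := arr aAdj (add (sum rRow (reg u)) (reg v))

/-- The test whether the edge between the vertices in the registers `u` and `v` lies in no
triangle. -/
def goodE (u v : ℕ) : Expr := and (adjE u v) (not (sum rY (and (adjE u rY) (adjE v rY))))

/-- The test for `Flagged`. -/
def flagE : Expr :=
  sum rU (sum rV (and (goodE rU rV)
    (and (sum rX (and (ne (reg rX) (reg rV)) (goodE rU rX)))
      (sum rX (and (ne (reg rX) (reg rU)) (goodE rV rX))))))

/-- The test for `Heavy`. -/
def heavyE : Expr :=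
  and (adjE rU rV) (add (not (goodE rU rV))
    (add (sum rX (and (lt (reg rV) (reg rX)) (goodE rU rX)))
      (sum rX (and (lt (reg rU) (reg rX)) (goodE rV rX)))))

/-- The number `n * n + 2`, which exceeds `1` and the size of every cut. -/
def bigE : Expr := add (sum rU (sum rV (const 1))) (const 2)

/-- The weight of the edge between the vertices in the registers `rU` and `rV`. -/
def weightE : Expr := cond (and (not flagE) heavyE) bigE (adjE rU rV)

/-- The total weight of the edges from chosen classes to the class of the vertex in `rI`. -/
def keyE : Expr :=
  sum rU (sum rV (cond (and (arr aChosen (arr aLab (reg rU)))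
    (not (ne (arr aLab (reg rV)) (reg rI)))) weightE (const 0)))

section Eval

variable {n : ℕ} {G : SimpleGraph (Fin n)} {s : State}

theorem adjE_eval (h : Holds G s) {u v : ℕ} (hu : u ≠ rRow) (hv : s.reg v < n) :
    (adjE u v).eval s = adjInd (natGraph G) (s.reg u) (s.reg v) := by
  simp [adjE, hu, h.arr, h.reg, inputState_arr G hv]

theorem adjE_iff (h : Holds G s) {u v : ℕ} (hu : u ≠ rRow) (hv : s.reg v < n) :
    (adjE u v).eval s ≠ 0 ↔ (natGraph G).Adj (s.reg u) (s.reg v) := by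
  simp [adjE_eval h hu hv, adjInd]

theorem goodE_iff (h : Holds G s) {u v : ℕ} (hu : u ≠ rRow) (hv : v ≠ rRow) (hu' : u ≠ rY)
    (hv' : v ≠ rY) (hvn : s.reg v < n) :
    (goodE u v).eval s ≠ 0 ↔ Good (natGraph G) (s.reg u) (s.reg v) := by
  rw [goodE, and_eval, adjE_iff h hu hvn, not_eval, sum_eval, Good]
  refine and_congr_right fun _ => not_congr ?_
  have key : ∀ k < n, (and (adjE u rY) (adjE v rY)).eval (s.setReg rY k) ≠ 0 ↔
      (natGraph G).Adj (s.reg u) k ∧ (natGraph G).Adj (s.reg v) k := by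
    intro k hk
    rw [and_eval, adjE_iff (h.setReg (by decide)) hu (by simpa),
      adjE_iff (h.setReg (by decide)) hv (by simpa)]
    simp [hu', hv']
  rw [h.reg]
  constructor
  · rintro ⟨k, hk, hh⟩; exact ⟨k, (key k hk).1 hh⟩
  · rintro ⟨k, hh⟩; exact ⟨k, natGraph_lt hh.1.symm, (key k (natGraph_lt hh.1.symm)).2 hh⟩

theorem good_lt {u v : ℕ} (h : Good (natGraph G) u v) : u < n ∧ v < n :=
  ⟨natGraph_lt h.1, natGraph_lt h.1.symm⟩

/-- The test whether the vertex in register `u` has a good edge to some `x` that satisfies a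
condition `P`, which the expression `c` tests for the vertex `x` in `rX`. -/
theorem exists_good_iff (h : Holds G s) {u : ℕ} (hu : u ≠ rRow) (hu' : u ≠ rY) (hu'' : u ≠ rX)
    (c : Expr) (P : ℕ → Prop) (hc : ∀ k, c.eval (s.setReg rX k) ≠ 0 ↔ P k) :
    (sum rX (and c (goodE u rX))).eval s ≠ 0 ↔ ∃ x, P x ∧ Good (natGraph G) (s.reg u) x := by
  have key : ∀ k < n, (and c (goodE u rX)).eval (s.setReg rX k) ≠ 0 ↔
      P k ∧ Good (natGraph G) (s.reg u) k := by
    intro k hk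
    rw [and_eval, goodE_iff (h.setReg (by decide)) hu (by decide) hu' (by decide) (by simpa), hc]
    simp [hu'']
  rw [sum_eval, h.reg]
  constructor
  · rintro ⟨k, hk, hh⟩; exact ⟨k, (key k hk).1 hh⟩
  · rintro ⟨k, hh⟩; exact ⟨k, (good_lt hh.2).2, (key k (good_lt hh.2).2).2 hh⟩

theorem flagE_iff (h : Holds G s) : flagE.eval s ≠ 0 ↔ Flagged (natGraph G) := by
  have key : ∀ u v, u < n → v < n → ((and (goodE rU rV)
    (and (sum rX (and (ne (reg rX) (reg rV)) (goodE rU rX)))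
      (sum rX (and (ne (reg rX) (reg rU)) (goodE rV rX))))).eval ((s.setReg rU u).setReg rV v) ≠ 0 ↔
      Good (natGraph G) u v ∧ (∃ x, x ≠ v ∧ Good (natGraph G) u x) ∧
        ∃ y, y ≠ u ∧ Good (natGraph G) v y) := by
    intro u v hu hv
    have h' : Holds G ((s.setReg rU u).setReg rV v) :=
      (h.setReg (by decide)).setReg (by decide)
    rw [and_eval, and_eval, goodE_iff h' (by decide) (by decide) (by decide) (by decide) (by simpa),
      exists_good_iff h' (by decide) (by decide) (by decide) _ (fun x => x ≠ v)
        (fun k => by rw [ne_eval]; simp),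
      exists_good_iff h' (by decide) (by decide) (by decide) _ (fun x => x ≠ u)
        (fun k => by rw [ne_eval]; simp)]
    simp
  simp only [flagE, Flagged]
  rw [sum_eval, h.reg]
  constructor
  · rintro ⟨u, hu, hh⟩
    rw [sum_eval, (h.setReg (by decide)).reg] at hh
    obtain ⟨v, hv, hh⟩ := hh
    exact ⟨u, v, (key u v hu hv).1 hh⟩
  · rintro ⟨u, v, hh⟩
    obtain ⟨hu, hv⟩ := good_lt hh.1
    refine ⟨u, hu, ?_⟩
    rw [sum_eval, (h.setReg (by decide)).reg]
    exact ⟨v, hv, (key u v hu hv).2 hh⟩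

theorem heavyE_iff (h : Holds G s) (hv : s.reg rV < n) :
    heavyE.eval s ≠ 0 ↔ Heavy (natGraph G) (s.reg rU) (s.reg rV) := by
  rw [heavyE, and_eval, add_eval, add_eval, not_eval, adjE_iff h (by decide) hv,
    goodE_iff h (by decide) (by decide) (by decide) (by decide) hv,
    exists_good_iff h (by decide) (by decide) (by decide) _ (fun x => s.reg rV < x)
      (fun k => by rw [lt_eval]; simp),
    exists_good_iff h (by decide) (by decide) (by decide) _ (fun x => s.reg rU < x)
      (fun k => by rw [lt_eval]; simp), Heavy]

theorem bigE_eval (h : Holds G s) : bigE.eval s = n * n + 2 := by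
  simp [bigE, h.reg]

theorem weightE_eval (h : Holds G s) (hv : s.reg rV < n) :
    weightE.eval s = weight (natGraph G) (n * n + 2) (s.reg rU) (s.reg rV) := by
  classical
  rw [weightE, eval, bigE_eval h, adjE_eval h (by decide) hv, weight]
  refine if_congr ?_ rfl rfl
  rw [and_eval, not_eval, flagE_iff h, heavyE_iff h hv]

theorem keyE_eval (h : Holds G s) :
    keyE.eval s = ∑ u ∈ range n, ∑ v ∈ range n,
      if s.arr aChosen (s.arr aLab u) ≠ 0 ∧ s.arr aLab v = s.reg rI then
        weight (natGraph G) (n * n + 2) u v else 0 := by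
  rw [keyE, eval, h.reg]
  refine sum_congr rfl fun u hu => ?_
  rw [eval, (h.setReg (by decide)).reg]
  refine sum_congr rfl fun v hv => ?_
  rw [eval, weightE_eval ((h.setReg (by decide)).setReg (by decide))
    (by simpa using mem_range.1 hv)]
  simp only [State.setReg_reg, eval]
  refine if_congr ?_ (by simp) rfl
  rw [and_eval, not_eval, ne_eval]
  simp

end Eval

namespace Cmd

/-- A loop that fills the first `n` cells of an array. The value for cell `k` may depend on the old
content of this cell. -/
theorem run_fill {i a : ℕ} {e : Expr} {s : State} (f : ℕ → ℕ)
    (h : ∀ k < s.reg 0, ∀ s' : State, s'.reg i = k → (∀ x, x ≠ i → s'.reg x = s.reg x) →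
      (∀ b, b ≠ a → s'.arr b = s.arr b) → s'.arr a k = s.arr a k → e.eval s' = f k) :
    ∀ k < s.reg 0, ((loop i (store a (Expr.reg i) e)).run s).arr a k = f k := by
  refine (run_loop (s := s) (fun k s' => (∀ j < k, s'.arr a j = f j) ∧
    ∀ j, k ≤ j → s'.arr a j = s.arr a j) ⟨fun j hj => absurd hj (Nat.not_lt_zero j),
      fun j _ => rfl⟩ ?_).1
  intro k hk s' h1 h2 h3 ⟨h4, h5⟩
  have he := h k hk s' h1 (fun x hx => h2 x hx rfl)
    (fun b hb => h3 b (by simpa [writesArr] using hb.symm)) (h5 k le_rfl)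
  refine ⟨fun j hj => ?_, fun j hj => ?_⟩
  · by_cases hjk : j = k
    · simp [run, h1, he, hjk]
    · simpa [run, h1, hjk] using h4 j (by omega)
  · have : j ≠ k := by omega
    simpa [run, h1, this] using h5 j (by omega)

end Cmd

open RAM.Cmd

/-- Find the class that is not chosen yet and has the largest key. Afterwards `rMax` contains
its key plus one, or `0` if there is no such class. -/
def selectC : Cmd :=
  seq (assign rMax (const 0))
    (loop rI (ite (and (not (ne (arr aLab (reg rI)) (reg rI)))
        (and (not (arr aChosen (reg rI))) (lt (reg rMax) (add keyE (const 1)))))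
      (seq (assign rMax (add keyE (const 1))) (assign rSel (reg rI))) skip))

/-- Append the class in `rSel` to the maximum adjacency ordering. -/
def appendC : Cmd :=
  seq (seq (assign rPrev (reg rCur)) (assign rCur (reg rSel)))
    (seq (assign rKey (sub (reg rMax) (const 1))) (store aChosen (reg rSel) (const 1)))

/-- Choose the next class of the maximum adjacency ordering, if there is one left. -/
def chooseC : Cmd :=
  seq selectC (ite (reg rMax) appendC skip)

/-- Compute a maximum adjacency ordering of the classes. Afterwards `rCur` and `rPrev` contain the
last two classes, with `n` in the place of a class that does not exist. -/
def orderC : Cmd :=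
  seq (loop rI (store aChosen (reg rI) (const 0)))
    (seq (assign rPrev (reg rN)) (seq (assign rCur (reg rN)) (loop rStep chooseC)))

/-- Record the cut that the maximum adjacency ordering ends with and merge the last two classes. -/
def mergeC : Cmd :=
  seq (assign rBest (cond (lt (reg rKey) (reg rBest)) (reg rKey) (reg rBest)))
    (loop rI (store aLab (reg rI)
      (cond (ne (arr aLab (reg rI)) (reg rCur)) (arr aLab (reg rI)) (reg rPrev))))

/-- One phase of the minimum cut search. -/
def phaseC : Cmd := seq orderC (ite (lt (reg rPrev) (reg rN)) mergeC skip)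

/-- The whole algorithm. -/
def matchingCutC : Cmd :=
  seq (loop rI (store aLab (reg rI) (reg rI)))
    (seq (assign rBest bigE)
      (seq (loop rPhase phaseC)
        (seq (assign rFound (lt (reg rBest) bigE))
          (assign rAnswer (cond flagE (cond (lt (reg rBest) (const 2)) (reg rBest) (const 2))
            (reg rBest))))))

section Verification

variable {n : ℕ} {G : SimpleGraph (Fin n)} {s : State}

/-- The total weight of the edges from chosen classes to the class `y`. -/
noncomputable def key (G : SimpleGraph (Fin n)) (s : State) (y : ℕ) : ℕ :=
  ∑ u ∈ range n, ∑ v ∈ range n, if s.arr aChosen (s.arr aLab u) ≠ 0 ∧ s.arr aLab v = y then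
    weight (natGraph G) (n * n + 2) u v else 0

/-- The class `y` is not chosen yet. -/
def Candidate (s : State) (y : ℕ) : Prop := s.arr aLab y = y ∧ ¬ s.arr aChosen y ≠ 0

/-- `selectC` finds a candidate with the largest key, if there is a candidate. -/
theorem selectC_spec (h : Holds G s) :
    ((selectC.run s).reg rMax = 0 ∧ ∀ y < n, ¬ Candidate s y) ∨
    ((selectC.run s).reg rSel < n ∧ Candidate s ((selectC.run s).reg rSel) ∧
      (selectC.run s).reg rMax = key G s ((selectC.run s).reg rSel) + 1 ∧
      ∀ y < n, Candidate s y → key G s y ≤ key G s ((selectC.run s).reg rSel)) := by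
  simp only [selectC, run]
  have h' : Holds G (s.setReg rMax ((const 0).eval s)) := h.setReg (by decide)
  have := run_loop (i := rI) (s := s.setReg rMax ((const 0).eval s))
    (p := ite (and (not (ne (arr aLab (reg rI)) (reg rI)))
        (and (not (arr aChosen (reg rI))) (lt (reg rMax) (add keyE (const 1)))))
      (seq (assign rMax (add keyE (const 1))) (assign rSel (reg rI))) skip)
    (fun k s' => (s'.reg rMax = 0 ∧ ∀ y < k, ¬ Candidate s y) ∨
      (s'.reg rSel < n ∧ Candidate s (s'.reg rSel) ∧ s'.reg rMax = key G s (s'.reg rSel) + 1 ∧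
        ∀ y < k, Candidate s y → key G s y ≤ key G s (s'.reg rSel))) (by simp) (by
    intro k hk s' h1 h2 h3 h4
    have hs' : Holds G s' := ⟨(h2 _ (by decide) (by decide)).trans h'.reg,
      (h3 _ (by decide)).trans h'.arr⟩
    have e1 : s'.arr aLab = s.arr aLab := h3 _ (by decide)
    have e2 : s'.arr aChosen = s.arr aChosen := h3 _ (by decide)
    have hkey : keyE.eval s' = key G s k := by rw [keyE_eval hs', key, e1, e2, h1]
    have hkn : k < n := by rwa [h'.reg] at hk
    simp only [run]
    have htest : (and (not (ne (arr aLab (reg rI)) (reg rI)))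
        (and (not (arr aChosen (reg rI))) (lt (reg rMax) (add keyE (const 1))))).eval s' ≠ 0 ↔
        Candidate s k ∧ s'.reg rMax < key G s k + 1 := by
      rw [and_eval, and_eval, not_eval, not_eval, ne_eval, lt_eval]
      simp only [eval, hkey, e1, e2, h1, Candidate, not_not]
      tauto
    split_ifs with ht
    · rw [htest] at ht
      right
      simp only [State.setReg_reg, eval, hkey, h1]
      refine ⟨by simpa, by simpa using ht.1, by simp, fun y hy hc => ?_⟩
      simp only [if_true, if_false, Nat.reduceEqDiff]
      rcases h4 with ⟨h5, h6⟩ | ⟨-, -, h5, h6⟩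
      · rcases Nat.lt_succ_iff_lt_or_eq.1 hy with h7 | rfl
        · exact absurd hc (h6 y h7)
        · exact le_rfl
      · rcases Nat.lt_succ_iff_lt_or_eq.1 hy with h7 | rfl
        · have := h6 y h7 hc; have := ht.2; omega
        · exact le_rfl
    · rw [htest] at ht
      simp only [State.setReg_reg, if_false, Nat.reduceEqDiff]
      rcases h4 with ⟨h5, h6⟩ | ⟨h5, h6, h7, h8⟩
      · refine .inl ⟨h5, fun y hy hc => ?_⟩
        rcases Nat.lt_succ_iff_lt_or_eq.1 hy with h7 | rfl
        · exact h6 y h7 hc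
        · exact ht ⟨hc, by omega⟩
      · refine .inr ⟨h5, h6, h7, fun y hy hc => ?_⟩
        rcases Nat.lt_succ_iff_lt_or_eq.1 hy with h9 | rfl
        · exact h8 y h9 hc
        · have : ¬ s'.reg rMax < key G s y + 1 := fun h => ht ⟨hc, h⟩
          omega)
  rw [h'.reg] at this
  exact this

/-- The classes in `C` are the first ones of a maximum adjacency ordering, and `rPrev` and
`rCur` contain the last two of them, as far as they exist. If there are two, then `rKey` contains the
weight of the cut that separates the last one from the others, and this is a lightest cut within `C`
between the last two. -/
structure Ordered (G : SimpleGraph (Fin n)) (s : State) (C : Finset ℕ) : Prop where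
  subset : C ⊆ reps (range n) (s.arr aLab)
  chosen : ∀ v < n, (s.arr aChosen v ≠ 0 ↔ v ∈ C)
  segment : Segment (reps (range n) (s.arr aLab))
    (contract (range n) (s.arr aLab) (weight (natGraph G) (n * n + 2))) C (s.reg rCur)
  last : (C = ∅ ∧ s.reg rPrev = n ∧ s.reg rCur = n) ∨ (C = {s.reg rCur} ∧ s.reg rPrev = n) ∨
    (s.reg rPrev ∈ C ∧ s.reg rCur ∈ C ∧ s.reg rPrev ≠ s.reg rCur ∧
      s.reg rKey = ∑ x ∈ C.erase (s.reg rCur),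
        contract (range n) (s.arr aLab) (weight (natGraph G) (n * n + 2)) x (s.reg rCur) ∧
      ∀ S, Splits S (s.reg rPrev) (s.reg rCur) → s.reg rKey ≤
        cut C (contract (range n) (s.arr aLab) (weight (natGraph G) (n * n + 2))) S)

theorem Ordered.congr {s' : State} {C : Finset ℕ} (h : Ordered G s C)
    (h1 : s'.arr aLab = s.arr aLab) (h2 : s'.arr aChosen = s.arr aChosen)
    (h3 : s'.reg rPrev = s.reg rPrev) (h4 : s'.reg rCur = s.reg rCur)
    (h5 : s'.reg rKey = s.reg rKey) : Ordered G s' C := by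
  obtain ⟨a, b, c, d⟩ := h
  constructor <;> simp only [h1, h2, h3, h4, h5] <;> assumption

/-- Every step appends one class to the ordering, until all classes are in it. -/
theorem chooseC_spec (h : Holds G s) (hlab : ∀ v < n, s.arr aLab v < n) {C : Finset ℕ}
    (hC : Ordered G s C) :
    ∃ C', Ordered G (chooseC.run s) C' ∧
      (#C' = #C + 1 ∨ C' = reps (range n) (s.arr aLab)) := by
  have e1 : (selectC.run s).arr aLab = s.arr aLab := run_arr (by decide) s
  have e2 : (selectC.run s).arr aChosen = s.arr aChosen := run_arr (by decide) s
  have e3 : (selectC.run s).reg rPrev = s.reg rPrev := run_reg (by decide) s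
  have e4 : (selectC.run s).reg rCur = s.reg rCur := run_reg (by decide) s
  have e5 : (selectC.run s).reg rKey = s.reg rKey := run_reg (by decide) s
  have hcand : ∀ y, y < n ∧ Candidate s y ↔ y ∈ reps (range n) (s.arr aLab) \ C := by
    intro y
    simp only [mem_sdiff, reps, mem_filter, mem_range, Candidate]
    constructor
    · rintro ⟨h1, h2, h3⟩; exact ⟨⟨h1, h2⟩, fun h => h3 ((hC.chosen y h1).2 h)⟩
    · rintro ⟨⟨h1, h2⟩, h3⟩; exact ⟨h1, h2, fun h => h3 ((hC.chosen y h1).1 h)⟩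
  have hkey : ∀ y, key G s y = ∑ x ∈ C,
      contract (range n) (s.arr aLab) (weight (natGraph G) (n * n + 2)) x y := by
    intro y
    rw [sum_contract, key]
    refine sum_congr rfl fun u hu => sum_congr rfl fun v _ => if_congr ?_ rfl rfl
    rw [hC.chosen _ (hlab u (mem_range.1 hu))]
  simp only [chooseC, run.eq_1, run.eq_4, run.eq_5]
  rcases selectC_spec h with ⟨h1, h2⟩ | ⟨h1, h2, h3, h4⟩
  · rw [if_neg (by simp [h1])]
    refine ⟨C, hC.congr e1 e2 e3 e4 e5, .inr (hC.subset.antisymm fun y hy => ?_)⟩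
    by_contra hyC
    have := (hcand y).2 (mem_sdiff.2 ⟨hy, hyC⟩)
    exact h2 y this.1 this.2
  · rw [if_pos (by simp [h3])]
    generalize hv : (selectC.run s).reg rSel = v at *
    have hvC := (hcand v).1 ⟨h1, h2⟩
    have hvC' := mem_sdiff.1 hvC
    obtain ⟨t, ht, f1, f2, f3, f4, f5⟩ : ∃ t, t = appendC.run (selectC.run s) ∧
        t.reg rPrev = s.reg rCur ∧ t.reg rCur = v ∧ t.reg rKey = key G s v ∧
        t.arr aLab = s.arr aLab ∧
        ∀ x, t.arr aChosen x = if x = v then 1 else s.arr aChosen x :=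
      ⟨_, rfl, by simp [appendC, run, e4], by simp [appendC, run, hv],
        by simp [appendC, run, h3], (run_arr (by decide) _).trans e1,
        fun x => by simp [appendC, run, e2, hv]⟩
    have hgoal : Ordered G t (insert v C) := by
      refine ⟨?_, fun x hx => ?_, ?_, ?_⟩
      · rw [f4, insert_subset_iff]
        exact ⟨hvC'.1, hC.subset⟩
      · have := hC.chosen x hx
        by_cases hxv : x = v <;> simp [f5, hxv] at this ⊢
        exact this
      · rw [f4, f2]
        refine hC.segment.insert (contract_comm (weight_comm (natGraph G) _)) hvC fun y hy => ?_
        have := (hcand y).2 hy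
        rw [← hkey, ← hkey]
        exact h4 y this.1 this.2
      · rw [f1, f2, f3, f4]
        have hcur : s.reg rCur ∈ C → (s.reg rCur ∈ insert v C ∧ v ∈ insert v C ∧
            s.reg rCur ≠ v ∧ key G s v = ∑ x ∈ (insert v C).erase v,
              contract (range n) (s.arr aLab) (weight (natGraph G) (n * n + 2)) x v ∧
            ∀ S, Splits S (s.reg rCur) v → key G s v ≤ cut (insert v C)
              (contract (range n) (s.arr aLab) (weight (natGraph G) (n * n + 2))) S) := by
          refine fun hc => ⟨mem_insert_of_mem hc, mem_insert_self _ _,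
            fun e => hvC'.2 (e ▸ hc), ?_, fun S hS => ?_⟩
          · rw [erase_insert hvC'.2, hkey]
          · rw [hkey]; exact hC.segment S v hvC (splits_comm.1 hS)
        rcases hC.last with ⟨g1, -, g2⟩ | ⟨g1, -⟩ | ⟨-, g1, -⟩
        · exact .inr (.inl ⟨by rw [g1]; rfl, g2⟩)
        · exact .inr (.inr (hcur (by rw [g1]; simp)))
        · exact .inr (.inr (hcur g1))
    exact ⟨insert v C, ht ▸ hgoal, .inl (card_insert_of_notMem hvC'.2)⟩

theorem orderC_spec (h : Holds G s) (hlab : ∀ v < n, s.arr aLab v < n) :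
    Ordered G (orderC.run s) (reps (range n) (s.arr aLab)) := by
  simp only [orderC, run.eq_4]
  set s₁ := (loop rI (store aChosen (reg rI) (const 0))).run s with hs₁
  have hz : ∀ v < s.reg 0, s₁.arr aChosen v = 0 :=
    run_fill (fun _ => 0) fun k hk s' _ _ _ _ => rfl
  have g1 : Holds G s₁ := h.run (by decide) (by decide)
  have e1 : s₁.arr aLab = s.arr aLab := run_arr (by decide) s
  simp only [run.eq_2]
  set s₂ := (s₁.setReg rPrev ((reg rN).eval s₁)).setReg rCur
    ((reg rN).eval (s₁.setReg rPrev ((reg rN).eval s₁))) with hs₂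
  have g2 : Holds G s₂ := (g1.setReg (by decide)).setReg (by decide)
  have e2 : s₂.arr aLab = s.arr aLab := e1
  have := run_loop (i := rStep) (p := chooseC) (s := s₂)
    (fun k s' => ∃ C, Ordered G s' C ∧ (k ≤ #C ∨ C = reps (range n) (s.arr aLab)))
    ⟨∅, ⟨by simp, fun v hv => by simp [hs₂, hz v (by rwa [h.reg])], .empty _ _ _,
      .inl ⟨rfl, by simp [hs₂, g1.reg], by simp [hs₂, g1.reg]⟩⟩, .inl (Nat.zero_le _)⟩ (by
      rintro k hk s' h1 h2 h3 ⟨C, hC, hCk⟩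
      have g3 : Holds G s' := ⟨(h2 _ (by decide) (by decide)).trans g2.reg,
        (h3 _ (by decide)).trans g2.arr⟩
      have e3 : s'.arr aLab = s.arr aLab := (h3 _ (by decide)).trans e2
      obtain ⟨C', hC', hcard⟩ := chooseC_spec g3 (by rwa [e3]) hC
      refine ⟨C', hC'.congr rfl rfl (by simp) (by simp) (by simp), ?_⟩
      rw [e3] at hcard
      rcases hcard with hcard | hcard
      · rcases hCk with hCk | hCk
        · left; omega
        · have := card_le_card hC'.subset
          have e4 : (chooseC.run s').arr aLab = s.arr aLab := (run_arr (by decide) s').trans e3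
          rw [e4, ← hCk] at this
          omega
      · exact .inr hcard)
  obtain ⟨C, hC, hCn⟩ := this
  have e3 : ((loop rStep chooseC).run s₂).arr aLab = s.arr aLab := (run_arr (by decide) s₂).trans e2
  have hsub := hC.subset
  rw [e3] at hsub
  rcases hCn with hCn | rfl
  · have : C = reps (range n) (s.arr aLab) := by
      refine eq_of_subset_of_card_le hsub (le_trans ?_ hCn)
      rw [g2.reg]
      exact (card_filter_le _ _).trans_eq (card_range n)
    rwa [← this]
  · exact hC

/-- A phase makes progress: it merges two classes, unless at most one class is left. -/
theorem phaseC_spec (h : Holds G s)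
    (hP : Progress (range n) (weight (natGraph G) (n * n + 2)) (n * n + 2) (s.arr aLab)
      (s.reg rBest)) :
    Progress (range n) (weight (natGraph G) (n * n + 2)) (n * n + 2) ((phaseC.run s).arr aLab)
        ((phaseC.run s).reg rBest) ∧
      (#(reps (range n) ((phaseC.run s).arr aLab)) + 1 ≤ #(reps (range n) (s.arr aLab)) ∨
        #(reps (range n) ((phaseC.run s).arr aLab)) ≤ 1) := by
  have hlab : ∀ v < n, s.arr aLab v < n := fun v hv =>
    mem_range.1 (hP.lab_mem v (mem_range.2 hv))
  have hO := orderC_spec h hlab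
  simp only [phaseC, run.eq_4, run.eq_5]
  generalize ht : orderC.run s = t at *
  have g : Holds G t := ht ▸ h.run (by decide) (by decide)
  have e1 : t.arr aLab = s.arr aLab := ht ▸ run_arr (by decide) s
  have e2 : t.reg rBest = s.reg rBest := ht ▸ run_reg (by decide) s
  have htest : (lt (reg rPrev) (reg rN)).eval t ≠ 0 ↔ t.reg rPrev < n := by
    rw [lt_eval, eval, eval, g.reg]
  split_ifs with hlt
  · rw [htest] at hlt
    rcases hO.last with ⟨-, h1, -⟩ | ⟨-, h1⟩ | ⟨h1, h2, h3, h4, h5⟩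
    · omega
    · omega
    · rw [e1] at h4 h5
      have hm : (mergeC.run t).reg rBest = min (t.reg rKey) (t.reg rBest) := by
        simp only [mergeC, run.eq_4]
        rw [run_reg (by decide)]
        simp only [run.eq_2, State.setReg_reg, if_true, eval]
        simp only [lt_eval, eval]
        split_ifs with hk
        · rw [min_eq_left hk.le]
        · rw [min_eq_right (not_lt.1 hk)]
      have hl : ∀ v ∈ range n, (mergeC.run t).arr aLab v =
          if s.arr aLab v = t.reg rCur then t.reg rPrev else s.arr aLab v := by
        intro v hv
        simp only [mergeC, run.eq_4]
        refine run_fill (fun v => if s.arr aLab v = t.reg rCur then t.reg rPrev else s.arr aLab v)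
          (fun k hk s' f1 f2 f3 f4 => ?_) v (by simpa [run.eq_2, g.reg] using hv)
        rw [eval, ← ite_not]
        simp only [ne_eval, eval, f1, f4, f2 rCur (by decide), f2 rPrev (by decide)]
        simp [run.eq_2, e1]
      have := hP.merge (weight_comm _ _) h1 h2 h3 (fun S hS => h4 ▸ h5 S hS) hl
      rw [← h4, ← e2, ← hm] at this
      exact ⟨this.1, .inl this.2.le⟩
  · rw [htest] at hlt
    simp only [run.eq_1, e1, e2]
    refine ⟨hP, .inr ?_⟩
    rcases hO.last with ⟨h1, -⟩ | ⟨h1, -⟩ | ⟨h1, -⟩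
    · simp [h1]
    · simp [h1]
    · exact absurd (mem_range.1 (mem_filter.1 h1).1) hlt

open Classical in
/-- The answer of the algorithm in terms of the minimum weight `best` of a cut; if no cut is lighter
than `n * n + 2`, then there is no matching cut. -/
theorem matchingCutC_spec (h : Holds G s) :
    ∃ best : ℕ, (best = n * n + 2 ∨ ∃ S, Proper (range n) S ∧
        cut (range n) (weight (natGraph G) (n * n + 2)) S = best) ∧
      (∀ S, Proper (range n) S → best ≤ cut (range n) (weight (natGraph G) (n * n + 2)) S) ∧
      (matchingCutC.run s).answer = if best < n * n + 2 then
        some (if Flagged (natGraph G) then min best 2 else best) else none := by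
  simp only [matchingCutC, run.eq_4]
  set s₁ := (loop rI (store aLab (reg rI) (reg rI))).run s
  have hl : ∀ v < s.reg 0, s₁.arr aLab v = v := run_fill (fun v => v) fun k _ s' h1 _ _ _ => h1
  have g1 : Holds G s₁ := h.run (by decide) (by decide)
  rw [h.reg] at hl
  simp only [run.eq_2]
  rw [bigE_eval g1]
  set s₂ := s₁.setReg rBest (n * n + 2) with hs₂
  have g2 : Holds G s₂ := g1.setReg (by decide)
  have hloop := run_loop (i := rPhase) (p := phaseC) (s := s₂)
    (fun k s' => Progress (range n) (weight (natGraph G) (n * n + 2)) (n * n + 2) (s'.arr aLab)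
      (s'.reg rBest) ∧ (#(reps (range n) (s'.arr aLab)) + k ≤ n ∨
        #(reps (range n) (s'.arr aLab)) ≤ 1))
    ⟨by simpa [hs₂] using Progress.init fun v hv => hl v (mem_range.1 hv),
      .inl ((card_filter_le _ _).trans_eq (card_range n))⟩ (by
    rintro k hk s' h1 h2 h3 ⟨hP, hR⟩
    have g3 : Holds G s' := ⟨(h2 _ (by decide) (by decide)).trans g2.reg,
        (h3 _ (by decide)).trans g2.arr⟩
    obtain ⟨hP', hR'⟩ := phaseC_spec g3 hP
    refine ⟨by simpa using hP', ?_⟩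
    simp only [State.setReg_arr]
    omega)
  rw [g2.reg] at hloop
  generalize ht : (loop rPhase phaseC).run s₂ = t at *
  have g3 : Holds G t := ht ▸ g2.run (by decide) (by decide)
  refine ⟨t.reg rBest, hloop.1.attained, fun S hS => hloop.1.le_cut (by omega) hS, ?_⟩
  have g4 := g3.setReg (x := rFound) (v := n * n + 2 - t.reg rBest) (by decide)
  have hv : (lt (reg rBest) bigE).eval t = n * n + 2 - t.reg rBest := by
    simp only [lt, eval, bigE_eval g3]
  rw [hv]
  simp only [State.answer, State.setReg_reg, if_true, if_false, Nat.reduceEqDiff]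
  by_cases hb : t.reg rBest < n * n + 2
  · rw [if_neg (by omega), if_pos hb, eval]
    simp only [flagE_iff g4]
    congr 1
    split_ifs with hF
    · simp only [eval, lt_eval]
      simp only [State.setReg_reg, if_false, Nat.reduceEqDiff]
      split_ifs <;> omega
    · simp
  · rw [if_pos (by omega), if_neg hb]

end Verification

end RAM

/-! ### Transfer to the input graph -/

namespace MatchingCut

open Finset MinCut RAM

theorem noClaw_natGraph {n : ℕ} {G : SimpleGraph (Fin n)} (h : ClawFree G) :
    NoClaw (natGraph G) := by
  intro a b c d hab hac had hbc hbd hcd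
  obtain ⟨ha, hb, hab⟩ := natGraph_adj.1 hab
  obtain ⟨_, hc, hac⟩ := natGraph_adj.1 hac
  obtain ⟨_, hd, had⟩ := natGraph_adj.1 had
  by_contra! hno
  obtain ⟨h1, h2, h3⟩ := hno
  have h1 : ¬ G.Adj ⟨b, hb⟩ ⟨c, hc⟩ := fun e => h1 (natGraph_adj.2 ⟨hb, hc, e⟩)
  have h2 : ¬ G.Adj ⟨b, hb⟩ ⟨d, hd⟩ := fun e => h2 (natGraph_adj.2 ⟨hb, hd, e⟩)
  have h3 : ¬ G.Adj ⟨c, hc⟩ ⟨d, hd⟩ := fun e => h3 (natGraph_adj.2 ⟨hc, hd, e⟩)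
  have h1' : ¬ G.Adj ⟨c, hc⟩ ⟨b, hb⟩ := fun e => h1 e.symm
  have h2' : ¬ G.Adj ⟨d, hd⟩ ⟨b, hb⟩ := fun e => h2 e.symm
  have h3' : ¬ G.Adj ⟨d, hd⟩ ⟨c, hc⟩ := fun e => h3 e.symm
  let f : Fin 1 ⊕ Fin 3 → Fin n :=
    Sum.elim (fun _ => ⟨a, ha⟩) ![⟨b, hb⟩, ⟨c, hc⟩, ⟨d, hd⟩]
  refine h ⟨⟨⟨f, ?_⟩, ?_⟩⟩
  · rintro (i | i) (j | j) hij
    · exact congrArg _ (Subsingleton.elim i j)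
    · exfalso
      fin_cases j <;> simp [f] at hij
      exacts [hab.ne (Fin.ext hij), hac.ne (Fin.ext hij), had.ne (Fin.ext hij)]
    · exfalso
      fin_cases i <;> simp [f] at hij
      exacts [hab.ne (Fin.ext hij.symm), hac.ne (Fin.ext hij.symm), had.ne (Fin.ext hij.symm)]
    · fin_cases i <;> fin_cases j <;> simp [f] at hij ⊢ <;> omega
  · intro x y
    change G.Adj (f x) (f y) ↔ _
    rcases x with i | i <;> rcases y with j | j
    · simp [f]
    · fin_cases j <;> simp [f, hab, hac, had]
    · fin_cases i <;> simp [f, hab.symm, hac.symm, had.symm]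
    · fin_cases i <;> fin_cases j <;> simp [f, h1, h2, h3, h1', h2', h3']

/-- The edges between `R` and its complement. -/
def crossing {V : Type*} (G : SimpleGraph V) (R : Set V) : Set (Sym2 V) :=
  {e | ∃ u ∈ R, ∃ v ∈ Rᶜ, G.Adj u v ∧ e = s(u, v)}

theorem ncard_crossing {n : ℕ} {G : SimpleGraph (Fin n)} {R : Set (Fin n)} {S : Finset ℕ}
    (h : ∀ u : Fin n, u ∈ R ↔ (u : ℕ) ∈ S) :
    (crossing G R).ncard = cut (range n) (adjInd (natGraph G)) S := by
  classical
  have h1 : crossing G R = (fun p : Fin n × Fin n => s(p.1, p.2)) ''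
      ({p : Fin n × Fin n | (p.1 ∈ R ∧ p.2 ∉ R) ∧ G.Adj p.1 p.2} : Finset _) := by
    ext e
    simp only [crossing, Set.mem_ofPred_eq, Set.mem_image, coe_filter, mem_univ, true_and,
      Prod.exists]
    constructor
    · rintro ⟨u, hu, v, hv, huv, rfl⟩; exact ⟨u, v, ⟨⟨hu, hv⟩, huv⟩, rfl⟩
    · rintro ⟨u, v, ⟨⟨hu, hv⟩, huv⟩, rfl⟩; exact ⟨u, hu, v, hv, huv, rfl⟩
  rw [h1, Set.InjOn.ncard_image, Set.ncard_coe_finset, card_filter]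
  · rw [← univ_product_univ, sum_product]
    unfold cut adjInd
    rw [sum_range]
    refine sum_congr rfl fun u _ => ?_
    rw [sum_range]
    refine sum_congr rfl fun v _ => ?_
    have : (natGraph G).Adj u v ↔ G.Adj u v := by simp [natGraph_adj]
    simp only [h, this, ite_and]
  · rintro ⟨u, v⟩ hp ⟨u', v'⟩ hp' he
    simp only [coe_filter, mem_univ, true_and, Set.mem_ofPred_eq] at hp hp'
    rcases Sym2.eq_iff.1 he with ⟨rfl, rfl⟩ | ⟨rfl, rfl⟩
    · rfl
    · exact absurd hp.1.1 hp'.1.2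

theorem isMatching_crossing_iff {n : ℕ} {G : SimpleGraph (Fin n)} {R : Set (Fin n)} {S : Finset ℕ}
    (h : ∀ u : Fin n, u ∈ R ↔ (u : ℕ) ∈ S) :
    (∀ e ∈ crossing G R, ∀ f ∈ crossing G R, e ≠ f → ∀ v, v ∈ e → v ∉ f) ↔
      Matching (natGraph G) S := by
  have hmem : ∀ u v : Fin n, G.Adj u v → Splits S u v → s(u, v) ∈ crossing G R := by
    intro u v huv hs
    simp only [Splits, ← h] at hs
    by_cases hu : u ∈ R
    · exact ⟨u, hu, v, fun hv => hs ⟨fun _ => hv, fun _ => hu⟩, huv, rfl⟩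
    · exact ⟨v, by tauto, u, hu, huv.symm, Sym2.eq_swap⟩
  have hmem' : ∀ e ∈ crossing G R, ∀ v ∈ e, ∃ w, e = s(v, w) ∧ G.Adj v w ∧ Splits S v w := by
    rintro e ⟨a, ha, b, hb, hab, rfl⟩ v hv
    have hb' : (b : ℕ) ∉ S := fun e => hb ((h b).2 e)
    have ha' := (h a).1 ha
    rcases Sym2.mem_iff.1 hv with rfl | rfl
    · exact ⟨b, rfl, hab, by unfold Splits; tauto⟩
    · exact ⟨a, Sym2.eq_swap, hab.symm, by unfold Splits; tauto⟩
  constructor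
  · intro hM u v x hv hx hsv hsx
    obtain ⟨hu, hvn, hv⟩ := natGraph_adj.1 hv
    obtain ⟨_, hxn, hx⟩ := natGraph_adj.1 hx
    by_contra hne
    refine hM _ (hmem ⟨u, hu⟩ ⟨v, hvn⟩ hv hsv) _ (hmem ⟨u, hu⟩ ⟨x, hxn⟩ hx hsx) (fun e => ?_) ⟨u, hu⟩
      (Sym2.mem_mk_left _ _) (Sym2.mem_mk_left _ _)
    exact hne (congrArg Fin.val (Sym2.congr_right.1 e))
  · intro hM e he f hf hef v hve hvf
    obtain ⟨w, rfl, hvw, hsw⟩ := hmem' e he v hve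
    obtain ⟨x, rfl, hvx, hsx⟩ := hmem' f hf v hvf
    have := hM v w x (natGraph_adj.2 ⟨v.2, w.2, hvw⟩) (natGraph_adj.2 ⟨v.2, x.2, hvx⟩) hsw hsx
    exact hef (by rw [Fin.ext this])

/-- The matching cuts of `G` as subsets of `{0, …, n - 1}`. -/
theorem mem_sizes_iff {n : ℕ} {G : SimpleGraph (Fin n)} {k : ℕ} :
    k ∈ sizes (range n) (natGraph G) ↔ ∃ M, IsMatchingCut G M ∧ M.ncard = k := by
  classical
  constructor
  · rintro ⟨S, ⟨⟨u, hu, huS⟩, v, hv, hvS⟩, hM, rfl⟩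
    have h : ∀ u : Fin n, u ∈ {u : Fin n | (u : ℕ) ∈ S} ↔ (u : ℕ) ∈ S := fun _ => Iff.rfl
    exact ⟨crossing G {u | (u : ℕ) ∈ S}, ⟨⟨_, ⟨⟨u, mem_range.1 hu⟩, huS⟩,
      ⟨⟨v, mem_range.1 hv⟩, hvS⟩, rfl⟩, (isMatching_crossing_iff h).2 hM⟩, ncard_crossing h⟩
  · rintro ⟨M, ⟨⟨R, ⟨u, hu⟩, ⟨v, hv⟩, rfl⟩, hM⟩, rfl⟩
    have h : ∀ u : Fin n, u ∈ R ↔ (u : ℕ) ∈ R.toFinset.map Fin.valEmbedding := by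
      intro u
      simp [Fin.val_inj]
    exact ⟨R.toFinset.map Fin.valEmbedding, ⟨⟨u, mem_range.2 u.2, (h u).1 hu⟩, v, mem_range.2 v.2,
      fun e => hv ((h v).2 e)⟩, (isMatching_crossing_iff h).1 hM, (ncard_crossing h).symm⟩

theorem cut_adjInd_lt {n : ℕ} (G : SimpleGraph ℕ) (S : Finset ℕ) :
    cut (range n) (adjInd G) S < n * n + 2 := by
  classical
  rw [cut_adjInd]
  have := card_filter_le (range n ×ˢ range n) fun p => (p.1 ∈ S ∧ p.2 ∉ S) ∧ G.Adj p.1 p.2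
  rw [card_product, card_range] at this
  omega

end MatchingCut

theorem theorem3p9 :
    RAM.PolyTimeSolvableOn (fun _ G => MatchingCut.ClawFree G)
      (fun _ G out => MatchingCut.IsMinMatchingCutAnswer G out) := by
  classical
  refine RAM.polyTimeSolvableOn_of_cmd RAM.matchingCutC 17 (by decide) (by decide)
    fun n G hG => ?_
  obtain ⟨best, hatt, hmin, hans⟩ := RAM.matchingCutC_spec (G := G) (s := RAM.inputState G)
    ⟨rfl, rfl⟩
  have hD : ∀ u v, (RAM.natGraph G).Adj u v → u ∈ Finset.range n := fun u v h =>
    Finset.mem_range.2 (RAM.natGraph_lt h)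
  obtain ⟨h1, h2⟩ := MatchingCut.isLeast_sizes hD (MatchingCut.noClaw_natGraph hG)
    (big := n * n + 2) (by omega) (fun S => MatchingCut.cut_adjInd_lt _ S) hatt hmin
  rw [hans]
  split_ifs with hb hF
  · obtain ⟨h3, h4⟩ := h1 hb
    rw [if_pos hF] at h3 h4
    exact ⟨MatchingCut.mem_sizes_iff.1 h3, fun M hM => h4 (MatchingCut.mem_sizes_iff.2 ⟨M, hM, rfl⟩)⟩
  · obtain ⟨h3, h4⟩ := h1 hb
    rw [if_neg hF] at h3 h4
    exact ⟨MatchingCut.mem_sizes_iff.1 h3, fun M hM => h4 (MatchingCut.mem_sizes_iff.2 ⟨M, hM, rfl⟩)⟩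
  · rintro ⟨M, hM⟩
    have := MatchingCut.mem_sizes_iff.2 ⟨M, hM, rfl⟩
    rw [h2 (by omega)] at this
    exact this
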